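/- A difference pattern is a finite word over the alphabet $\{-,0,+\}$. The difference $u-v$ of two binary words $u,v\in\{0,1\}^n$ is the word of length $n$ over $\{-,0,+\}$ obtained by symbol-by-symbol subtraction. For a finite set $D$ of patterns and $n\ge 1$, let $\delta_n(D)$ be the largest cardinality of a set $C\subseteq\{0,1\}^n$ such that for all distinct $u,v\in C$ the word $u-v$ contains no word of $D$ as a subword (a block of consecutive letters). The capacity of $D$ is $$\mathrm{cap}(D)=\lim_{n\to\infty}\frac{\log_2\delta_n(D)}{n}.$$ **Corollary.** The problem of determining, for a given finite set $D$ of forbidden patterns over $\{-,0,+\}$, whether $\mathrm{cap}(D)>0$ can be solved in polynomial time. That is, there are a (multi-stack) Turing machine and a polynomial $p$ such that, for every finite list $d_1,\dots,d_k$ of patterns ($k\ge 0$), given as the string $d_1\#d_2\#\cdots d_k\#$ over the alphabet $\{-,0,+,\#\}$, of length $N=k+\sum_{i}|d_i|$, the machine halts after at most $p(N)$ steps and outputs whether $\mathrm{cap}(\{d_1,\dots,d_k\})>0$. -/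

import Mathlib

namespace ForbiddenDifference

/-- A binary word of length `n`. -/
abbrev BinWord (n : ℕ) : Type := Fin n → Bool

/-- A difference pattern: a finite word over the alphabet `{-, 0, +}`, with the three letters
written as the elements `-1`, `0`, `1` of `SignType`. -/
abbrev Pattern : Type := List SignType

/-- The difference `a - b ∈ {-1, 0, +1}` of two bits. -/
def bitDiff : Bool → Bool → SignType
  | true, false => 1
  | false, true => -1
  | false, false => 0
  | true, true => 0

/-- The symbol-by-symbol difference `u - v` of two binary words of length `n`. -/
def wordDiff {n : ℕ} (u v : BinWord n) : Pattern :=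
  List.ofFn fun i => bitDiff (u i) (v i)

/-- The code `C` avoids `D`: no difference of two distinct words of `C` contains a word of `D`
as a subword, that is, none is of the form `x ++ d ++ y` with `d ∈ D`
(`d <:+: w` means `∃ x y, x ++ d ++ y = w`). -/
def Avoids {n : ℕ} (C : Finset (BinWord n)) (D : Set Pattern) : Prop :=
  ∀ u ∈ C, ∀ v ∈ C, u ≠ v → ∀ d ∈ D, ¬ d <:+: wordDiff u v

open Classical in
/-- `δ_n(D)`: the largest cardinality of a set of binary words of length `n` that avoids `D`. -/
noncomputable def delta (D : Set Pattern) (n : ℕ) : ℕ :=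
  (Finset.univ.filter fun C : Finset (BinWord n) => Avoids C D).sup Finset.card

/-- The capacity `cap(D) = lim_{n → ∞} log₂ δ_n(D) / n`. The limit always exists, see
`tendsto_capacity`. -/
noncomputable def capacity (D : Set Pattern) : ℝ :=
  Filter.limUnder Filter.atTop fun n : ℕ => Real.logb 2 (delta D n) / n

theorem card_le_delta {D : Set Pattern} {n : ℕ} {C : Finset (BinWord n)} (h : Avoids C D) :
    C.card ≤ delta D n := by
  classical
  unfold delta
  exact Finset.le_sup (f := Finset.card) (by simpa using h)

theorem delta_le {D : Set Pattern} {n k : ℕ}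
    (h : ∀ C : Finset (BinWord n), Avoids C D → C.card ≤ k) : delta D n ≤ k := by
  classical
  unfold delta
  refine Finset.sup_le fun C hC => h C ?_
  simpa using hC

theorem one_le_delta (D : Set Pattern) (n : ℕ) : 1 ≤ delta D n := by
  have h : Avoids {(fun _ => false : BinWord n)} D := by
    intro u hu v hv huv
    rw [Finset.mem_singleton] at hu hv
    exact absurd (hu.trans hv.symm) huv
  simpa using card_le_delta h

theorem wordDiff_append {m n : ℕ} (u v : BinWord (m + n)) :
    wordDiff u v =
      wordDiff (fun i => u (Fin.castAdd n i)) (fun i => v (Fin.castAdd n i)) ++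
        wordDiff (fun i => u (Fin.natAdd m i)) (fun i => v (Fin.natAdd m i)) := by
  unfold wordDiff
  rw [List.ofFn_add]
  rfl

theorem eq_of_parts {m n : ℕ} {u v : BinWord (m + n)}
    (h₁ : (fun i => u (Fin.castAdd n i)) = fun i => v (Fin.castAdd n i))
    (h₂ : (fun i => u (Fin.natAdd m i)) = fun i => v (Fin.natAdd m i)) : u = v := by
  funext i
  induction i using Fin.addCases with
  | left i => exact congrFun h₁ i
  | right i => exact congrFun h₂ i

theorem delta_add_le (D : Set Pattern) (m n : ℕ) :
    delta D (m + n) ≤ delta D m * delta D n := by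
  classical
  refine delta_le fun C hC => ?_
  let p : BinWord (m + n) → BinWord m := fun u i => u (Fin.castAdd n i)
  let s : BinWord (m + n) → BinWord n := fun u i => u (Fin.natAdd m i)
  have hp : Avoids (C.image p) D := by
    intro a ha b hb hab d hd hin
    obtain ⟨u, hu, rfl⟩ := Finset.mem_image.1 ha
    obtain ⟨v, hv, rfl⟩ := Finset.mem_image.1 hb
    refine hC u hu v hv (fun h => hab (by rw [h])) d hd ?_
    rw [wordDiff_append]
    exact hin.trans (List.prefix_append _ _).isInfix
  have hs : ∀ a ∈ C.image p, (C.filter fun u => p u = a).card ≤ delta D n := by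
    intro a _
    have hinj : Set.InjOn s (C.filter fun u => p u = a) := by
      intro u hu v hv huv
      have hu' := (Finset.mem_filter.1 (Finset.mem_coe.1 hu)).2
      have hv' := (Finset.mem_filter.1 (Finset.mem_coe.1 hv)).2
      exact eq_of_parts (hu'.trans hv'.symm) huv
    rw [← Finset.card_image_of_injOn hinj]
    refine card_le_delta ?_
    intro x hx y hy hxy d hd hin
    obtain ⟨u, hu, rfl⟩ := Finset.mem_image.1 hx
    obtain ⟨v, hv, rfl⟩ := Finset.mem_image.1 hy
    refine hC u (Finset.mem_filter.1 hu).1 v (Finset.mem_filter.1 hv).1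
      (fun h => hxy (by rw [h])) d hd ?_
    rw [wordDiff_append]
    exact hin.trans (List.suffix_append _ _).isInfix
  calc C.card = ∑ a ∈ C.image p, (C.filter fun u => p u = a).card :=
        Finset.card_eq_sum_card_image p C
    _ ≤ ∑ _a ∈ C.image p, delta D n := Finset.sum_le_sum hs
    _ = (C.image p).card * delta D n := by simp
    _ ≤ delta D m * delta D n := Nat.mul_le_mul_right _ (card_le_delta hp)

/-- The limit that defines the capacity exists. -/
theorem tendsto_capacity (D : Set Pattern) :
    Filter.Tendsto (fun n : ℕ => Real.logb 2 (delta D n) / n) Filter.atTop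
      (nhds (capacity D)) := by
  have hpos : ∀ n, (0 : ℝ) < delta D n := fun n => by exact_mod_cast one_le_delta D n
  have hsub : Subadditive fun n : ℕ => Real.logb 2 (delta D n) := by
    intro m n
    rw [← Real.logb_mul (hpos m).ne' (hpos n).ne']
    exact Real.logb_le_logb_of_le (by norm_num) (hpos _) (by exact_mod_cast delta_add_le D m n)
  have hbdd : BddBelow (Set.range fun n : ℕ => Real.logb 2 (delta D n) / n) := by
    refine ⟨0, ?_⟩
    rintro _ ⟨n, rfl⟩
    exact div_nonneg (Real.logb_nonneg (by norm_num) (by exact_mod_cast one_le_delta D n))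
      (Nat.cast_nonneg n)
  exact tendsto_nhds_limUnder ⟨_, hsub.tendsto_lim hbdd⟩

/-- A finite list of patterns written as a string over the four-letter alphabet
`{-, 0, +, separator}`: each pattern is written out letter by letter and followed by one separator
(`none`). The length of the string is the sum of the lengths of the patterns plus their number. -/
def encodePatterns (L : List Pattern) : List (Option SignType) :=
  L.flatMap fun w => w.map some ++ [none]

/-- Different lists of patterns have different encodings. -/
theorem encodePatterns_injective : Function.Injective encodePatterns := by
  have key : ∀ (w w' : Pattern) (s s' : List (Option SignType)),
      w.map some ++ none :: s = w'.map some ++ none :: s' → w = w' ∧ s = s' := by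
    intro w
    induction w with
    | nil => intro w' s s' h; cases w' <;> simp_all
    | cons a w ih =>
      intro w' s s' h
      cases w' with
      | nil => simp at h
      | cons b w' =>
        simp only [List.map_cons, List.cons_append, List.cons.injEq, Option.some.injEq] at h
        obtain ⟨h₁, h₂⟩ := ih w' s s' h.2
        exact ⟨by rw [h.1, h₁], h₂⟩
  intro L
  induction L with
  | nil => intro L' h; cases L' <;> simp_all [encodePatterns]
  | cons w L ih =>
    intro L' h
    cases L' with
    | nil => simp [encodePatterns] at h
    | cons w' L' =>
      have h' : w.map some ++ none :: encodePatterns L =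
          w'.map some ++ none :: encodePatterns L' := by
        simpa [encodePatterns] using h
      obtain ⟨h₁, h₂⟩ := key _ _ _ _ h'
      rw [h₁, ih h₂]

/-- The property `P` of the inputs `a : α`, given to the machine as the strings `enc a`, can be
decided in polynomial time: a multi-stack Turing machine with finitely many states outputs the
truth value of `P a`, within a number of steps that is bounded by a fixed polynomial in the length
of `enc a`. -/
def DecidableInPolyTime {α Γ : Type} (enc : α → List Γ) (P : α → Prop) : Prop :=
  ∃ f : α → Bool, (∀ a, f a = true ↔ P a) ∧
    Nonempty (Turing.TM2ComputableInPolyTime enc Computability.encodeBool f)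

end ForbiddenDifference

/-! The proof reduces positivity of the capacity to a combinatorial condition, decides that
condition by a reachability search in a finite automaton, and runs the search on a stack machine in
polynomial time.

Criterion. Let `n` bound the lengths of all patterns. The capacity is positive iff some word `0^n +
x 0^n` contains neither a pattern nor the negative of one. If the capacity is positive, some code
has more than `2^(2n)` words, so two of them agree on their first and last `n` letters. Their
difference, taken in the order that makes its first nonzero letter `+`, ends with such a word
(`exists_avoidsSigned_of_capacity_pos`). Conversely, let `f = 0^n + x`, and concatenate `k` blocks,
each the positive or the negative part of `f`. Differences of these `2^k` words are built from
blocks `f`, `-f` and `0`. A window of length at most `n` that crosses into the next block sees only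
zeros there, so it is a window of `± 0^n + x 0^n` or all zero (`avoids_blockWord`). Hence the
capacity is at least `1 / (n + 1 + |x|)`.

Search. Words are grown at the head, so all patterns are reversed. What matters about a word is the
set of its prefixes among the suffixes of the reversed patterns, and this set is determined by the
longest such prefix, the state. There are polynomially many states, and the state of `a :: y`
depends only on `a` and the state of `y`. The criterion says that the state of `0^n` can be reached
from that of `+ 0^n` through valid words (`hasCycle_iff`). For `n` the sum of the pattern lengths is
taken.

Complexity. A small language of stack programs is simulated step by step by Turing machines
(`Exec.simulate`). Data are coded as binary trees, and `PolyTime` is closed under composition,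
pairing, case distinction and folds whose accumulator grows by a polynomial amount per step
(`PolyTime.foldl`). The test is assembled from these operations. -/

namespace StackProgram

/-! ### Stack programs and their simulation by Turing machines. -/

open Function Turing

/-- Structured programs on a family of stacks, where stack `k` holds symbols of type `Γ k`. The
command `pop k next` removes the top symbol of stack `k` and continues with `next` of this symbol
(`next none` if the stack is empty). The command `loop k body` pops symbols from stack `k`,
running `body` on each of them, until the stack is found empty. -/
inductive Cmd {K : Type} (Γ : K → Type) : Type
  | skip : Cmd Γ
  | push (k : K) (x : Γ k) : Cmd Γ
  | pop (k : K) (next : Option (Γ k) → Cmd Γ) : Cmd Γ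
  | seq (c d : Cmd Γ) : Cmd Γ
  | loop (k : K) (body : Γ k → Cmd Γ) : Cmd Γ

/-- Sequential composition of programs. -/
infixr:60 " ;; " => Cmd.seq

variable {K : Type} {Γ : K → Type}

/-- `Exec c S S' t`: the program `c` leads from the stacks `S` to the stacks `S'` in `t` steps. -/
inductive Exec [DecidableEq K] :
    Cmd Γ → (∀ k, List (Γ k)) → (∀ k, List (Γ k)) → ℕ → Prop
  | skip (S) : Exec .skip S S 1
  | push (k x S) : Exec (.push k x) S (update S k (x :: S k)) 1
  | pop {k next S S' t} :
      Exec (next (S k).head?) (update S k (S k).tail) S' t → Exec (.pop k next) S S' (t + 1)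
  | seq {c d S S' S'' t t'} : Exec c S S' t → Exec d S' S'' t' → Exec (.seq c d) S S'' (t + t')
  | loop_nil {k body S} : S k = [] → Exec (.loop k body) S S 1
  | loop_cons {k body S S' S'' x l t t'} : S k = x :: l → Exec (body x) (update S k l) S' t →
      Exec (.loop k body) S' S'' t' → Exec (.loop k body) S S'' (t + t' + 1)

/-- The labels of the machine for a program. -/
def Cmd.Label : Cmd Γ → Type
  | .skip => Unit
  | .push _ _ => Unit
  | .pop k next => Option (Σ o : Option (Γ k), (next o).Label)
  | .seq c d => c.Label ⊕ d.Label
  | .loop k body => Option (Σ x : Γ k, (body x).Label)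

theorem Cmd.finite_label [∀ k, Finite (Γ k)] (c : Cmd Γ) : Finite c.Label := by
  induction c with
  | skip => exact inferInstanceAs (Finite Unit)
  | push => exact inferInstanceAs (Finite Unit)
  | pop k next ih => exact inferInstanceAs (Finite (Option (Σ o, (next o).Label)))
  | seq c d ih₁ ih₂ => exact inferInstanceAs (Finite (c.Label ⊕ d.Label))
  | loop k body ih => exact inferInstanceAs (Finite (Option (Σ x, (body x).Label)))

/-- The label at which a program starts. -/
def Cmd.entry : (c : Cmd Γ) → c.Label
  | .skip => ()
  | .push _ _ => ()
  | .pop _ _ => (none : Option _)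
  | .seq c _ => Sum.inl c.entry
  | .loop _ _ => (none : Option _)

/-- The statements of the machine for a program, as part of a machine with labels `Λ` that contains
the labels of the program by the map `emb`. The program leaves to the label `exit`. The internal
state remembers the symbols that were popped last. -/
def Cmd.code [DecidableEq K] {Λ : Type} :
    (c : Cmd Γ) → (emb : c.Label → Λ) → (exit : Λ) → c.Label →
      TM2.Stmt Γ Λ (∀ k, Option (Γ k))
  | .skip, _, exit, _ => .goto fun _ => exit
  | .push k x, _, exit, _ => .push k (fun _ => x) (.goto fun _ => exit)
  | .pop k next, emb, exit, l =>
    match (show Option (Σ o : Option (Γ k), (next o).Label) from l) with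
    | none => .pop k (fun v o => update v k o)
        (.goto fun v => emb (some ⟨v k, (next (v k)).entry⟩ : Option _))
    | some ⟨o, l⟩ => (next o).code (fun l => emb (some ⟨o, l⟩ : Option _)) exit l
  | .seq c d, emb, exit, l =>
    match (show c.Label ⊕ d.Label from l) with
    | .inl l => c.code (fun l => emb (.inl l : _ ⊕ _)) (emb (.inr d.entry : _ ⊕ _)) l
    | .inr l => d.code (fun l => emb (.inr l : _ ⊕ _)) exit l
  | .loop k body, emb, exit, l =>
    match (show Option (Σ x : Γ k, (body x).Label) from l) with
    | none => .pop k (fun v o => update v k o)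
        (.goto fun v => match v k with
          | none => exit
          | some x => emb (some ⟨x, (body x).entry⟩ : Option _))
    | some ⟨x, l⟩ =>
      (body x).code (fun l => emb (some ⟨x, l⟩ : Option _)) (emb (none : Option _)) l

/-- Induction on the execution. The embedding and the exit label vary because subprograms sit inside
larger machines; a loop body, for instance, exits to the label of its loop. The internal state `v`
is arbitrary, since a jump reads only the entry that the pop in the same step has just written. -/
theorem Exec.simulate [DecidableEq K] {c : Cmd Γ} {S S' : ∀ k, List (Γ k)} {t : ℕ}
    (h : Exec c S S' t) {Λ : Type} (M : Λ → TM2.Stmt Γ Λ (∀ k, Option (Γ k)))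
    (emb : c.Label → Λ) (exit : Λ) (hM : ∀ l, M (emb l) = c.code emb exit l)
    (v : ∀ k, Option (Γ k)) :
    ∃ v', (flip bind (TM2.step M))^[t] (some ⟨some (emb c.entry), v, S⟩) =
      some ⟨some exit, v', S'⟩ := by
  induction h generalizing exit v with
  | skip S =>
    refine ⟨v, ?_⟩
    simp [flip, hM, Cmd.code]
  | push k x S =>
    refine ⟨v, ?_⟩
    simp [flip, hM, Cmd.code]
  | @pop k next S S' t h ih =>
    obtain ⟨v', hv'⟩ := ih (fun l => emb (some ⟨_, l⟩ : Option _)) exit (fun l => hM _)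
      (update v k (S k).head?)
    refine ⟨v', ?_⟩
    rw [Function.iterate_succ_apply, ← hv']
    congr 1
    have := hM (none : Option _)
    simp only [flip, Option.bind_eq_bind, Option.bind_some]
    rw [Cmd.entry, TM2.step, this]
    simp [Cmd.code]
    rw [Function.update_self]
  | @seq c d S S' S'' t t' h₁ h₂ ih₁ ih₂ =>
    obtain ⟨v₁, hv₁⟩ := ih₁ (fun l => emb (.inl l : _ ⊕ _)) (emb (.inr d.entry : _ ⊕ _))
      (fun l => hM _) v
    obtain ⟨v₂, hv₂⟩ := ih₂ (fun l => emb (.inr l : _ ⊕ _)) exit (fun l => hM _) v₁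
    refine ⟨v₂, ?_⟩
    rw [add_comm, Function.iterate_add_apply, Cmd.entry, hv₁, hv₂]
  | @loop_nil k body S hS =>
    refine ⟨update v k none, ?_⟩
    have := hM (none : Option _)
    simp only [flip, Function.iterate_one, Option.bind_eq_bind, Option.bind_some]
    rw [Cmd.entry, TM2.step, this]
    simp [Cmd.code, hS]
  | @loop_cons k body S S' S'' x l t t' hS h₁ h₂ ih₁ ih₂ =>
    obtain ⟨v₁, hv₁⟩ := ih₁ (fun l => emb (some ⟨_, l⟩ : Option _)) (emb (none : Option _))
      (fun l => hM _) (update v k (some x))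
    obtain ⟨v₂, hv₂⟩ := ih₂ emb exit hM v₁
    refine ⟨v₂, ?_⟩
    rw [Function.iterate_succ_apply, add_comm, Function.iterate_add_apply, ← hv₂]
    refine congrArg _ ?_
    refine Eq.trans ?_ hv₁
    refine congrArg _ ?_
    have := hM (none : Option _)
    simp only [flip, Option.bind_eq_bind, Option.bind_some]
    rw [Cmd.entry, TM2.step, this]
    simp [Cmd.code, hS]

/-- The program `c` leads from the stacks `S` to the stacks `S'` in at most `T` steps. -/
def Runs [DecidableEq K] (c : Cmd Γ) (S S' : ∀ k, List (Γ k)) (T : ℕ) : Prop :=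
  ∃ t ≤ T, Exec c S S' t

section Runs

variable [DecidableEq K] {c d : Cmd Γ} {S S' S'' : ∀ k, List (Γ k)} {T T' : ℕ}

theorem Runs.mono (h : Runs c S S' T) (hT : T ≤ T') : Runs c S S' T' :=
  let ⟨t, ht, e⟩ := h
  ⟨t, ht.trans hT, e⟩

theorem Runs.skip : Runs .skip S S 1 := ⟨1, le_rfl, .skip S⟩

theorem Runs.push {k : K} {x : Γ k} (h : update S k (x :: S k) = S') :
    Runs (.push k x) S S' 1 := ⟨1, le_rfl, h ▸ .push k x S⟩

theorem Runs.pop {k : K} {next : Option (Γ k) → Cmd Γ}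
    (h : Runs (next (S k).head?) (update S k (S k).tail) S' T) :
    Runs (.pop k next) S S' (T + 1) :=
  let ⟨t, ht, e⟩ := h
  ⟨t + 1, Nat.succ_le_succ ht, .pop e⟩

theorem Runs.seq (h : Runs c S S' T) (h' : Runs d S' S'' T') : Runs (c ;; d) S S'' (T + T') :=
  let ⟨t, ht, e⟩ := h
  let ⟨t', ht', e'⟩ := h'
  ⟨t + t', Nat.add_le_add ht ht', .seq e e'⟩

theorem Runs.loop_nil {k : K} {body : Γ k → Cmd Γ} (h : S k = []) :
    Runs (.loop k body) S S 1 := ⟨1, le_rfl, .loop_nil h⟩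

theorem Runs.loop_cons {k : K} {body : Γ k → Cmd Γ} {x : Γ k} {l : List (Γ k)} (h : S k = x :: l)
    (h₁ : Runs (body x) (update S k l) S' T) (h₂ : Runs (.loop k body) S' S'' T') :
    Runs (.loop k body) S S'' (T + T' + 1) :=
  let ⟨t, ht, e⟩ := h₁
  let ⟨t', ht', e'⟩ := h₂
  ⟨t + t' + 1, by omega, .loop_cons h e e'⟩

end Runs

/-- The machine that runs a program and halts. -/
noncomputable def machine [DecidableEq K] [Fintype K] [∀ k, Fintype (Γ k)] (c : Cmd Γ)
    (k₀ k₁ : K) : FinTM2 where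
  K := K
  k₀ := k₀
  k₁ := k₁
  Γ := Γ
  Λ := Option c.Label
  main := some c.entry
  ΛFin := have := c.finite_label; Fintype.ofFinite _
  σ := ∀ k, Option (Γ k)
  initialState := fun _ => none
  m
    -- The halting configuration `haltList` has the initial internal state, so the memory is reset;
    -- this is the one extra step in `Runs.outputsInTime`.
    | none => .load (fun _ _ => none) .halt
    | some l => c.code some none l

/-- The left side is the form in which `initList` and `haltList` give the stacks. -/
theorem dite_eq_update [DecidableEq K] (k₀ : K) (l : List (Γ k₀)) :
    (fun k => dite (k = k₀) (fun h => (by rw [h]; exact l : List (Γ k))) fun _ => []) =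
      update (fun _ => []) k₀ l := by
  funext k
  by_cases hk : k = k₀
  · subst hk; simp
  · simp [hk]

theorem Runs.outputsInTime [DecidableEq K] [Fintype K] [∀ k, Fintype (Γ k)] {c : Cmd Γ} {k₀ k₁ : K}
    {l : List (Γ k₀)} {l' : List (Γ k₁)} {T : ℕ}
    (h : Runs c (update (fun _ => []) k₀ l) (update (fun _ => []) k₁ l') T) :
    Nonempty (TM2OutputsInTime (machine c k₀ k₁) l (some l') (T + 1)) := by
  obtain ⟨t, ht, e⟩ := h
  obtain ⟨v, hv⟩ := e.simulate (machine c k₀ k₁).m some none (fun _ => rfl) (fun _ => none)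
  refine ⟨{ steps := t + 1, evals_in_steps := ?_, steps_le_m := Nat.succ_le_succ ht }⟩
  have h₀ : initList (machine c k₀ k₁) l =
      (⟨some (some c.entry), fun _ => none, update (fun _ => []) k₀ l⟩ :
        TM2.Cfg Γ (Option c.Label) (∀ k, Option (Γ k))) :=
    congrArg (TM2.Cfg.mk (some (some c.entry)) fun _ => none) (dite_eq_update k₀ l)
  have h₁ : haltList (machine c k₀ k₁) l' =
      (⟨none, fun _ => none, update (fun _ => []) k₁ l'⟩ :
        TM2.Cfg Γ (Option c.Label) (∀ k, Option (Γ k))) :=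
    congrArg (TM2.Cfg.mk none fun _ => none) (dite_eq_update k₁ l')
  have h₂ : (flip bind (machine c k₀ k₁).step)^[t] (some (initList (machine c k₀ k₁) l)) =
      some (⟨some none, v, update (fun _ => []) k₁ l'⟩ :
        TM2.Cfg Γ (Option c.Label) (∀ k, Option (Γ k))) := by
    rw [h₀]
    exact hv
  refine (Function.iterate_succ_apply' _ _ _).trans ?_
  refine (congrArg _ h₂).trans ?_
  exact congrArg some h₁.symm

end StackProgram

/-! ### Binary trees on stacks: moving, copying and comparing. -/

namespace StackProgram

open Function Turing

/-- Binary trees. -/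
inductive BTree : Type
  | leaf : BTree
  | node (l r : BTree) : BTree

namespace BTree

/-- The prefix code of a binary tree. -/
def bits : BTree → List Bool
  | leaf => [false]
  | node l r => true :: (l.bits ++ r.bits)

/-- The length of the prefix code of a binary tree. -/
def size : BTree → ℕ
  | leaf => 1
  | node l r => l.size + r.size + 1

theorem length_bits (x : BTree) : x.bits.length = x.size := by
  induction x with
  | leaf => rfl
  | node l r ihl ihr => simp [bits, size, ihl, ihr]

theorem size_pos (x : BTree) : 0 < x.size := by
  cases x <;> simp [size]

/-- The code is self-delimiting. The remainders `s` and `t` are needed for the induction, where the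
right subtree follows the left one. -/
theorem bits_append_inj {x y : BTree} {s t : List Bool} (h : x.bits ++ s = y.bits ++ t) :
    x = y ∧ s = t := by
  induction x generalizing y s t with
  | leaf =>
    cases y with
    | leaf => simpa [bits] using h
    | node l r => simp [bits] at h
  | node l r ihl ihr =>
    cases y with
    | leaf => simp [bits] at h
    | node l' r' =>
      simp only [bits, List.cons_append, List.append_assoc, List.cons.injEq, true_and] at h
      obtain ⟨rfl, h₁⟩ := ihl h
      obtain ⟨rfl, h₂⟩ := ihr h₁
      exact ⟨rfl, h₂⟩

theorem bits_injective : Function.Injective bits := fun x y h =>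
  (bits_append_inj (s := []) (t := []) (by simpa using h)).1

/-- The tree for a truth value. -/
def ofBool : Bool → BTree
  | true => node leaf leaf
  | false => leaf

end BTree

/-- The names of the stacks: one for the input, one for data, and three auxiliary ones. -/
inductive Stk : Type
  | input | data | a | b | c
  deriving DecidableEq

instance : Fintype Stk := ⟨{.input, .data, .a, .b, .c}, fun k => by cases k <;> simp⟩

/-- The alphabets of the stacks: the input has its own one, the other stacks hold bits. -/
def Sym (A : Type) : Stk → Type
  | .input => A
  | .data => Bool
  | .a => Bool
  | .b => Bool
  | .c => Bool

noncomputable instance {A : Type} [Fintype A] : ∀ k, Fintype (Sym A k)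
  | .input => inferInstanceAs (Fintype A)
  | .data => inferInstanceAs (Fintype Bool)
  | .a => inferInstanceAs (Fintype Bool)
  | .b => inferInstanceAs (Fintype Bool)
  | .c => inferInstanceAs (Fintype Bool)

variable {A : Type}

/-- The family of stacks with the given contents. -/
def conf (i : List A) (d a b c : List Bool) : ∀ k, List (Sym A k)
  | .input => i
  | .data => d
  | .a => a
  | .b => b
  | .c => c

section conf

variable (i : List A) (d a b c : List Bool)

@[simp] theorem update_conf_input (x : List A) :
    update (conf i d a b c) .input x = conf x d a b c := by
  funext k; cases k <;> rfl

@[simp] theorem update_conf_data (x : List Bool) :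
    update (conf i d a b c) .data x = conf i x a b c := by
  funext k; cases k <;> rfl

@[simp] theorem update_conf_a (x : List Bool) :
    update (conf i d a b c) .a x = conf i d x b c := by
  funext k; cases k <;> rfl

@[simp] theorem update_conf_b (x : List Bool) :
    update (conf i d a b c) .b x = conf i d a x c := by
  funext k; cases k <;> rfl

@[simp] theorem update_conf_c (x : List Bool) :
    update (conf i d a b c) .c x = conf i d a b x := by
  funext k; cases k <;> rfl

variable {i d a b c}

theorem Runs.push_data (x : Bool) :
    Runs (.push (Γ := Sym A) .data x) (conf i d a b c) (conf i (x :: d) a b c) 1 :=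
  .push (update_conf_data i d a b c (x :: d))

theorem Runs.push_a (x : Bool) :
    Runs (.push (Γ := Sym A) .a x) (conf i d a b c) (conf i d (x :: a) b c) 1 :=
  .push (update_conf_a i d a b c (x :: a))

theorem Runs.push_b (x : Bool) :
    Runs (.push (Γ := Sym A) .b x) (conf i d a b c) (conf i d a (x :: b) c) 1 :=
  .push (update_conf_b i d a b c (x :: b))

theorem Runs.push_c (x : Bool) :
    Runs (.push (Γ := Sym A) .c x) (conf i d a b c) (conf i d a b (x :: c)) 1 :=
  .push (update_conf_c i d a b c (x :: c))

variable {x : Bool} {S : ∀ k, List (Sym A k)} {T : ℕ}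

theorem Runs.pop_data {next : Option Bool → Cmd (Sym A)}
    (h : Runs (next (some x)) (conf i d a b c) S T) :
    Runs (.pop .data next) (conf i (x :: d) a b c) S (T + 1) :=
  .pop ((update_conf_data i (x :: d) a b c d).symm ▸ h)

theorem Runs.pop_b {next : Option Bool → Cmd (Sym A)}
    (h : Runs (next (some x)) (conf i d a b c) S T) :
    Runs (.pop .b next) (conf i d a (x :: b) c) S (T + 1) :=
  .pop ((update_conf_b i d a (x :: b) c b).symm ▸ h)

theorem Runs.pop_b_nil {next : Option Bool → Cmd (Sym A)}
    (h : Runs (next none) (conf i d a [] c) S T) :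
    Runs (.pop .b next) (conf i d a [] c) S (T + 1) :=
  .pop ((update_conf_b i d a [] c []).symm ▸ h)

theorem Runs.pop_c {next : Option Bool → Cmd (Sym A)}
    (h : Runs (next (some x)) (conf i d a b c) S T) :
    Runs (.pop .c next) (conf i d a b (x :: c)) S (T + 1) :=
  .pop ((update_conf_c i d a b (x :: c) c).symm ▸ h)

theorem Runs.pop_c_nil {next : Option Bool → Cmd (Sym A)}
    (h : Runs (next none) (conf i d a b []) S T) :
    Runs (.pop .c next) (conf i d a b []) S (T + 1) :=
  .pop ((update_conf_c i d a b [] []).symm ▸ h)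

variable {S' : ∀ k, List (Sym A k)} {T' : ℕ} {body : Bool → Cmd (Sym A)}

theorem Runs.loop_a (h : Runs (body x) (conf i d a b c) S T) (h' : Runs (.loop .a body) S S' T') :
    Runs (.loop .a body) (conf i d (x :: a) b c) S' (T + T' + 1) :=
  .loop_cons rfl ((update_conf_a i d (x :: a) b c a).symm ▸ h) h'

theorem Runs.loop_b (h : Runs (body x) (conf i d a b c) S T) (h' : Runs (.loop .b body) S S' T') :
    Runs (.loop .b body) (conf i d a (x :: b) c) S' (T + T' + 1) :=
  .loop_cons rfl ((update_conf_b i d a (x :: b) c b).symm ▸ h) h'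

theorem Runs.loop_c (h : Runs (body x) (conf i d a b c) S T) (h' : Runs (.loop .c body) S S' T') :
    Runs (.loop .c body) (conf i d a b (x :: c)) S' (T + T' + 1) :=
  .loop_cons rfl ((update_conf_c i d a b (x :: c) c).symm ▸ h) h'

theorem Runs.loop_input {y : A} {body : A → Cmd (Sym A)} (h : Runs (body y) (conf i d a b c) S T)
    (h' : Runs (.loop .input body) S S' T') :
    Runs (.loop .input body) (conf (y :: i) d a b c) S' (T + T' + 1) :=
  .loop_cons rfl ((update_conf_input (y :: i) d a b c i).symm ▸ h) h'

end conf

variable {i : List A} {d a b : List Bool}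

/-- The body of a loop on the stack `c` that passes a tree from the data stack to `push`, bit by bit.
The stack `c` holds one symbol for every tree that is still to be read. -/
def parse (push : Bool → Cmd (Sym A)) : Cmd (Sym A) :=
  .pop Stk.data fun o : Option Bool => match o with
    | some true => push true ;; .push Stk.c true ;; .push Stk.c true
    | some false => push false
    | none => .skip

/-- Move the trees that are counted by the stack `c` to the stack `a`. -/
def moveLoopA : Cmd (Sym A) := .loop Stk.c fun _ => parse fun x => .push Stk.a x

/-- Move the trees that are counted by the stack `c` to the stack `b`. -/
def moveLoopB : Cmd (Sym A) := .loop Stk.c fun _ => parse fun x => .push Stk.b x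

/-- Move the top tree to the stack `a`. -/
def moveA : Cmd (Sym A) := .push Stk.c true ;; moveLoopA

/-- Move the top tree to the stack `b`. -/
def moveB : Cmd (Sym A) := .push Stk.c true ;; moveLoopB

/-- Stated with a continuation `h`, so that for a node the induction hypotheses of both subtrees can
be chained. A node replaces its one mark on `c` by two. The bits arrive on `a` in reverse order. -/
theorem runs_moveLoopA {S : ∀ k, List (Sym A k)} {c : List Bool} {T : ℕ} (x : BTree)
    (h : Runs moveLoopA (conf i d (x.bits.reverse ++ a) b c) S T) :
    Runs moveLoopA (conf i (x.bits ++ d) a b (true :: c)) S (5 * x.size + T) := by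
  induction x generalizing d a c T with
  | leaf =>
    exact (Runs.loop_c (Runs.pop_data (Runs.push_a _)) h).mono (by simp [BTree.size])
  | node l r ihl ihr =>
    rw [BTree.bits, List.cons_append, List.append_assoc]
    refine (Runs.loop_c (Runs.pop_data
      ((Runs.push_a _).seq ((Runs.push_c _).seq (Runs.push_c _))))
      (ihl (ihr (T := T) ?_))).mono ?_
    · simpa [BTree.bits] using h
    · simp [BTree.size]; omega

theorem runs_moveLoopB {S : ∀ k, List (Sym A k)} {c : List Bool} {T : ℕ} (x : BTree)
    (h : Runs moveLoopB (conf i d a (x.bits.reverse ++ b) c) S T) :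
    Runs moveLoopB (conf i (x.bits ++ d) a b (true :: c)) S (5 * x.size + T) := by
  induction x generalizing d b c T with
  | leaf =>
    exact (Runs.loop_c (Runs.pop_data (Runs.push_b _)) h).mono (by simp [BTree.size])
  | node l r ihl ihr =>
    rw [BTree.bits, List.cons_append, List.append_assoc]
    refine (Runs.loop_c (Runs.pop_data
      ((Runs.push_b _).seq ((Runs.push_c _).seq (Runs.push_c _))))
      (ihl (ihr (T := T) ?_))).mono ?_
    · simpa [BTree.bits] using h
    · simp [BTree.size]; omega

theorem runs_moveA (x : BTree) :
    Runs (moveA (A := A)) (conf i (x.bits ++ d) a b []) (conf i d (x.bits.reverse ++ a) b [])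
      (5 * x.size + 2) :=
  ((Runs.push_c _).seq (runs_moveLoopA x (.loop_nil rfl))).mono (by omega)

theorem runs_moveB (x : BTree) :
    Runs (moveB (A := A)) (conf i (x.bits ++ d) a b []) (conf i d a (x.bits.reverse ++ b) [])
      (5 * x.size + 2) :=
  ((Runs.push_c _).seq (runs_moveLoopB x (.loop_nil rfl))).mono (by omega)

/-- Move the stack `a` to the data stack. -/
def unloadA : Cmd (Sym A) := .loop Stk.a fun x => .push Stk.data x

/-- Move the stack `b` to the data stack. -/
def unloadB : Cmd (Sym A) := .loop Stk.b fun x => .push Stk.data x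

/-- Move the stack `b` to the stack `a`. -/
def transferBA : Cmd (Sym A) := .loop Stk.b fun x => .push Stk.a x

/-- Move the stack `a` to the data stack and, at the same time, to the stack `b`. -/
def copyA : Cmd (Sym A) :=
  .loop Stk.a fun x => .push Stk.data (show Bool from x) ;; .push Stk.b (show Bool from x)

/-- Empty the stack `a`. -/
def clearA : Cmd (Sym A) := .loop Stk.a fun _ => .skip

/-- Empty the stack `b`. -/
def clearB : Cmd (Sym A) := .loop Stk.b fun _ => .skip

/-- Empty the stack `c`. -/
def clearC : Cmd (Sym A) := .loop Stk.c fun _ => .skip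

variable {c : List Bool}

theorem runs_unloadA (l : List Bool) :
    Runs (unloadA (A := A)) (conf i d l b c) (conf i (l.reverse ++ d) [] b c)
      (2 * l.length + 1) := by
  induction l generalizing d with
  | nil => exact .loop_nil rfl
  | cons x l ih =>
    rw [List.reverse_cons, List.append_assoc]
    exact (Runs.loop_a (Runs.push_data _) ih).mono (by simp; omega)

theorem runs_unloadB (l : List Bool) :
    Runs (unloadB (A := A)) (conf i d a l c) (conf i (l.reverse ++ d) a [] c)
      (2 * l.length + 1) := by
  induction l generalizing d with
  | nil => exact .loop_nil rfl
  | cons x l ih =>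
    rw [List.reverse_cons, List.append_assoc]
    exact (Runs.loop_b (Runs.push_data _) ih).mono (by simp; omega)

theorem runs_transferBA (l : List Bool) :
    Runs (transferBA (A := A)) (conf i d a l c) (conf i d (l.reverse ++ a) [] c)
      (2 * l.length + 1) := by
  induction l generalizing a with
  | nil => exact .loop_nil rfl
  | cons x l ih =>
    rw [List.reverse_cons, List.append_assoc]
    exact (Runs.loop_b (Runs.push_a _) ih).mono (by simp; omega)

theorem runs_copyA (l : List Bool) :
    Runs (copyA (A := A)) (conf i d l b c) (conf i (l.reverse ++ d) [] (l.reverse ++ b) c)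
      (3 * l.length + 1) := by
  induction l generalizing d b with
  | nil => exact .loop_nil rfl
  | cons x l ih =>
    rw [List.reverse_cons, List.append_assoc, List.append_assoc]
    exact (Runs.loop_a ((Runs.push_data _).seq (Runs.push_b _)) ih).mono (by simp; omega)

theorem runs_clearA (l : List Bool) :
    Runs (clearA (A := A)) (conf i d l b c) (conf i d [] b c) (2 * l.length + 1) := by
  induction l with
  | nil => exact .loop_nil rfl
  | cons x l ih => exact (Runs.loop_a Runs.skip ih).mono (by simp; omega)

theorem runs_clearB (l : List Bool) :
    Runs (clearB (A := A)) (conf i d a l c) (conf i d a [] c) (2 * l.length + 1) := by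
  induction l with
  | nil => exact .loop_nil rfl
  | cons x l ih => exact (Runs.loop_b Runs.skip ih).mono (by simp; omega)

theorem runs_clearC (l : List Bool) :
    Runs (clearC (A := A)) (conf i d a b l) (conf i d a b []) (2 * l.length + 1) := by
  induction l with
  | nil => exact .loop_nil rfl
  | cons x l ih => exact (Runs.loop_c Runs.skip ih).mono (by simp; omega)

/-- Remove the top tree. -/
def drop : Cmd (Sym A) := moveA ;; clearA

theorem runs_drop (x : BTree) :
    Runs (drop (A := A)) (conf i (x.bits ++ d) [] [] []) (conf i d [] [] [])
      (10 * x.size + 10) :=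
  ((runs_moveA x).seq (runs_clearA _)).mono (by simp [BTree.length_bits]; omega)

/-- Duplicate the top tree. -/
def dup : Cmd (Sym A) := moveA ;; copyA ;; transferBA ;; unloadA

theorem runs_dup (x : BTree) :
    Runs (dup (A := A)) (conf i (x.bits ++ d) [] [] []) (conf i (x.bits ++ (x.bits ++ d)) [] [] [])
      (20 * x.size + 10) := by
  have h₁ := runs_moveA (i := i) (d := d) (a := []) (b := []) x
  have h₂ := runs_copyA (i := i) (d := d) (b := []) (c := []) (x.bits.reverse ++ [])
  have h₃ := runs_transferBA (i := i) (d := x.bits ++ d) (a := []) (c := []) x.bits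
  have h₄ := runs_unloadA (i := i) (d := x.bits ++ d) (b := []) (c := []) x.bits.reverse
  simp only [List.append_nil, List.reverse_reverse] at h₁ h₂ h₃ h₄
  exact (h₁.seq (h₂.seq (h₃.seq h₄))).mono (by simp [BTree.length_bits]; omega)

/-- Swap the two top trees. -/
def swap : Cmd (Sym A) := moveA ;; moveB ;; unloadA ;; unloadB

theorem runs_swap (x y : BTree) :
    Runs (swap (A := A)) (conf i (x.bits ++ (y.bits ++ d)) [] [] [])
      (conf i (y.bits ++ (x.bits ++ d)) [] [] []) (10 * (x.size + y.size) + 10) := by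
  have h₁ := runs_moveA (i := i) (d := y.bits ++ d) (a := []) (b := []) x
  have h₂ := runs_moveB (i := i) (d := d) (a := x.bits.reverse) (b := []) y
  have h₃ := runs_unloadA (i := i) (d := d) (b := y.bits.reverse) (c := []) x.bits.reverse
  have h₄ := runs_unloadB (i := i) (d := x.bits ++ d) (a := []) (c := []) y.bits.reverse
  simp only [List.append_nil, List.reverse_reverse] at h₁ h₂ h₃ h₄
  exact (h₁.seq (h₂.seq (h₃.seq h₄))).mono (by simp [BTree.length_bits]; omega)

/-- Push the given bits. -/
def pushBits : List Bool → Cmd (Sym A)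
  | [] => .skip
  | x :: l => pushBits l ;; .push Stk.data x

theorem runs_pushBits (l : List Bool) :
    Runs (pushBits (A := A) l) (conf i d a b c) (conf i (l ++ d) a b c) (l.length + 1) := by
  induction l with
  | nil => exact .skip
  | cons x l ih => exact (ih.seq (Runs.push_data x)).mono (by simp)

/-- Empty the stack `a`, removing a symbol from `b` for every symbol of `a`, and put a mark on `c`
for every mismatch. -/
def compareAB : Cmd (Sym A) := .loop Stk.a fun x : Bool => .pop Stk.b fun o : Option Bool =>
  if o = some x then .skip else .push Stk.c true

/-- If `l` is longer than `m`, popping the empty stack `b` counts as a mismatch; if `m` is longer,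
symbols stay on `b`. So equality shows as both `b` and `c` being empty at the end. -/
theorem runs_compareAB (l m : List Bool) :
    ∃ m' c', m'.length ≤ m.length ∧ c'.length ≤ l.length + c.length ∧
      Runs (compareAB (A := A)) (conf i d l m c) (conf i d [] m' c') (3 * l.length + 1) ∧
      (c' = [] ∧ m' = [] ↔ c = [] ∧ l = m) := by
  induction l generalizing m c with
  | nil => exact ⟨m, c, le_rfl, by simp, .loop_nil rfl, by simp [eq_comm]⟩
  | cons x l ih =>
    cases m with
    | nil =>
      obtain ⟨m', c', hm, hc, h, e⟩ := ih (c := true :: c) []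
      refine ⟨m', c', hm, hc.trans (by simp; omega),
        (Runs.loop_a (Runs.pop_b_nil (T := 1) ?_) h).mono (by simp; omega), by simp [e]⟩
      rw [if_neg (by simp)]
      exact Runs.push_c _
    | cons y m =>
      by_cases hxy : y = x
      · obtain ⟨m', c', hm, hc, h, e⟩ := ih (c := c) m
        refine ⟨m', c', hm.trans (by simp), hc.trans (by simp),
          (Runs.loop_a (Runs.pop_b (T := 1) ?_) h).mono (by simp; omega), by simp [e, hxy]⟩
        rw [if_pos (by simp [hxy])]
        exact Runs.skip
      · obtain ⟨m', c', hm, hc, h, e⟩ := ih (c := true :: c) m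
        refine ⟨m', c', hm.trans (by simp), hc.trans (by simp; omega),
          (Runs.loop_a (Runs.pop_b (T := 1) ?_) h).mono (by simp; omega),
          by simp [e, Ne.symm hxy]⟩
        rw [if_neg (by simpa using hxy)]
        exact Runs.push_c _

/-- Replace the two top trees by the truth value of their equality. -/
def eqTest : Cmd (Sym A) :=
  moveA ;; moveB ;; compareAB ;; .pop Stk.c fun o : Option Bool =>
    if o = none then
      .pop Stk.b fun o : Option Bool =>
        if o = none then pushBits (BTree.ofBool true).bits
        else clearB ;; pushBits (BTree.ofBool false).bits
    else clearB ;; clearC ;; pushBits (BTree.ofBool false).bits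

open Classical in
theorem runs_eqTest (x y : BTree) :
    Runs (eqTest (A := A)) (conf i (x.bits ++ (y.bits ++ d)) [] [] [])
      (conf i ((BTree.ofBool (decide (x = y))).bits ++ d) [] [] [])
      (20 * (x.size + y.size) + 20) := by
  have h₁ := runs_moveA (i := i) (d := y.bits ++ d) (a := []) (b := []) x
  have h₂ := runs_moveB (i := i) (d := d) (a := x.bits.reverse) (b := []) y
  obtain ⟨m', c', hm, hc, h₃, e⟩ :=
    runs_compareAB (i := i) (d := d) (c := []) x.bits.reverse y.bits.reverse
  simp only [List.append_nil, true_and, List.reverse_inj, BTree.bits_injective.eq_iff,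
    List.length_reverse, BTree.length_bits, List.length_nil] at h₁ h₂ h₃ e hm hc
  refine (h₁.seq (h₂.seq (h₃.seq
    (T' := 10 * (x.size + y.size) + 12) ?_))).mono (by omega)
  cases c' with
  | nil =>
    refine (Runs.pop_c_nil ?_).mono (Nat.le_refl _)
    rw [if_pos rfl]
    cases m' with
    | nil =>
      refine (Runs.pop_b_nil ?_).mono (Nat.le_refl _)
      rw [if_pos rfl, decide_eq_true (e.1 ⟨rfl, rfl⟩)]
      exact (runs_pushBits _).mono (by simp [BTree.ofBool, BTree.bits])
    | cons z m' =>
      refine (Runs.pop_b ?_).mono (Nat.le_refl _)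
      rw [if_neg (by simp), decide_eq_false (fun h => by simpa using e.2 h)]
      refine ((runs_clearB _).seq (runs_pushBits _)).mono ?_
      simp [BTree.ofBool, BTree.bits] at hm ⊢; omega
  | cons z c' =>
    refine (Runs.pop_c ?_).mono (Nat.le_refl _)
    rw [if_neg (by simp), decide_eq_false (fun h => by simpa using e.2 h)]
    refine ((runs_clearB _).seq ((runs_clearC _).seq (runs_pushBits _))).mono ?_
    simp [BTree.ofBool, BTree.bits] at hc ⊢; omega

end StackProgram

/-! ### Polynomial-time functions on data coded by trees. -/

namespace StackProgram

open Function Turing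

/-- A type whose elements are coded by binary trees. -/
class Code (α : Type) where
  /-- The tree that codes an element. -/
  enc : α → BTree
  enc_injective : Injective enc

/-- The size of the tree that codes an element. -/
def csize {α : Type} [Code α] (x : α) : ℕ := (Code.enc x).size

instance : Code Bool :=
  ⟨BTree.ofBool, fun x y h => by cases x <;> cases y <;> simp_all [BTree.ofBool]⟩

instance {α β : Type} [Code α] [Code β] : Code (α × β) :=
  ⟨fun x => .node (Code.enc x.1) (Code.enc x.2), fun x y h => by
    simp only [BTree.node.injEq] at h
    exact Prod.ext (Code.enc_injective h.1) (Code.enc_injective h.2)⟩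

/-- The tree that codes a list. -/
def encList {α : Type} [Code α] : List α → BTree
  | [] => .leaf
  | a :: l => .node (Code.enc a) (encList l)

instance {α : Type} [Code α] : Code (List α) :=
  ⟨encList, fun l => by
    induction l with
    | nil => intro m h; cases m <;> simp_all [encList]
    | cons a l ih =>
      intro m h
      cases m with
      | nil => simp [encList] at h
      | cons b m =>
        simp only [encList, BTree.node.injEq] at h
        rw [Code.enc_injective h.1, ih h.2]⟩

instance {α : Type} [Code α] : Code (Option α) :=
  ⟨fun o => o.elim .leaf fun a => .node .leaf (Code.enc a), fun x y h => by
    cases x <;> cases y <;> simp_all [Code.enc_injective.eq_iff]⟩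

instance : Code SignType :=
  ⟨fun s => match s with
    | .zero => .leaf
    | .pos => .node .leaf .leaf
    | .neg => .node .leaf (.node .leaf .leaf), fun x y h => by cases x <;> cases y <;> simp_all⟩

section csize

variable {α β : Type} [Code α] [Code β]

theorem csize_pos (x : α) : 0 < csize x := BTree.size_pos _

theorem csize_prod (x : α × β) : csize x = csize x.1 + csize x.2 + 1 := rfl

theorem csize_mk (x : α) (y : β) : csize (x, y) = csize x + csize y + 1 := rfl

@[simp] theorem csize_nil : csize ([] : List α) = 1 := rfl

@[simp] theorem csize_cons (a : α) (l : List α) : csize (a :: l) = csize a + csize l + 1 := rfl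

theorem csize_bool_le (b : Bool) : csize b ≤ 3 := by cases b <;> decide

theorem length_le_csize (l : List α) : l.length ≤ csize l := by
  induction l with
  | nil => simp
  | cons a l ih => simp; omega

theorem csize_le_of_mem {a : α} {l : List α} (h : a ∈ l) : csize a ≤ csize l := by
  induction l with
  | nil => simp at h
  | cons b l ih =>
    rcases List.mem_cons.1 h with rfl | h
    · simp; omega
    · have := ih h; simp; omega

theorem csize_tail_le (l : List α) : csize l.tail ≤ csize l := by
  cases l <;> simp; omega

theorem csize_le_of_sublist {l m : List α} (h : l.Sublist m) : csize l ≤ csize m := by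
  induction h with
  | slnil => exact le_rfl
  | cons a _ ih => simp; omega
  | cons_cons a _ ih => simp; omega

@[simp] theorem csize_append (l m : List α) : csize (l ++ m) + 1 = csize l + csize m := by
  induction l with
  | nil => simp; omega
  | cons a l ih => simp; omega

end csize

section bits

variable {α β : Type} [Code α] [Code β]

theorem bits_prod (x : α) (y : β) (d : List Bool) : (Code.enc (x, y)).bits ++ d =
    true :: ((Code.enc x).bits ++ ((Code.enc y).bits ++ d)) := by
  simp [Code.enc, BTree.bits]

theorem bits_cons (a : α) (l : List α) (d : List Bool) : (Code.enc (a :: l)).bits ++ d =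
    true :: ((Code.enc a).bits ++ ((Code.enc l).bits ++ d)) := by
  simp [Code.enc, encList, BTree.bits]

end bits

theorem eval_mono (p : Polynomial ℕ) {m n : ℕ} (h : m ≤ n) : p.eval m ≤ p.eval n := by
  rw [Polynomial.eval_eq_sum, Polynomial.eval_eq_sum]
  exact Finset.sum_le_sum fun i _ => Nat.mul_le_mul_left _ (Nat.pow_le_pow_left h i)

/-- The function `f` is computed in polynomial time by a program that replaces the tree for `x` at
the top of the data stack by the tree for `f x`. -/
def PolyTime (A : Type) {α β : Type} [Code α] [Code β] (f : α → β) : Prop :=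
  ∃ (c : Cmd (Sym A)) (p : Polynomial ℕ), ∀ x, csize (f x) ≤ p.eval (csize x) ∧ ∀ i d,
    Runs c (conf i ((Code.enc x).bits ++ d) [] [] []) (conf i ((Code.enc (f x)).bits ++ d) [] [] [])
      (p.eval (csize x))

namespace PolyTime

variable {A α β γ δ : Type} [Code α] [Code β] [Code γ] [Code δ]

theorem id : PolyTime A (fun x : α => x) :=
  ⟨.skip, .X, fun x => ⟨by simp, fun i d =>
    Runs.skip.mono (by simpa using Nat.succ_le_of_lt (csize_pos x))⟩⟩

theorem comp {f : β → γ} {g : α → β} (hf : PolyTime A f) (hg : PolyTime A g) :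
    PolyTime A (fun x => f (g x)) := by
  obtain ⟨c, p, hc⟩ := hf
  obtain ⟨d, q, hd⟩ := hg
  refine ⟨d ;; c, q + p.comp q, fun x => ⟨?_, fun i s => ?_⟩⟩
  · have := ((hc (g x)).1).trans (eval_mono p (hd x).1)
    simp only [Polynomial.eval_add, Polynomial.eval_comp]
    omega
  · simp only [Polynomial.eval_add, Polynomial.eval_comp]
    exact ((hd x).2 i s).seq (((hc (g x)).2 i s).mono (eval_mono p (hd x).1))

theorem pair {f : α → β} {g : α → γ} (hf : PolyTime A f) (hg : PolyTime A g) :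
    PolyTime A (fun x => (f x, g x)) := by
  obtain ⟨c, p, hc⟩ := hf
  obtain ⟨d, q, hd⟩ := hg
  -- The final `true` is the node bit that joins the two adjacent trees into a pair.
  refine ⟨dup ;; d ;; swap ;; c ;; .push Stk.data true, p + q + (10 * q + 30 * .X + 30),
    fun x => ⟨?_, fun i s => ?_⟩⟩
  · have h₁ := (hc x).1
    have h₂ := (hd x).1
    simp [csize_mk]
    omega
  · have h₂ := (hd x).1
    rw [bits_prod]
    refine Runs.mono ((runs_dup _).seq (((hd x).2 _ _).seq ((runs_swap _ _).seq
      (((hc x).2 _ _).seq (Runs.push_data _))))) ?_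
    simp only [csize] at h₂ ⊢
    simp
    omega

theorem const (b : β) : PolyTime A (fun _ : α => b) := by
  refine ⟨drop ;; pushBits (Code.enc b).bits, 10 * .X + 11 + .C (csize b),
    fun x => ⟨by simp, fun i d => ((runs_drop _).seq (runs_pushBits _)).mono ?_⟩⟩
  simp [csize, BTree.length_bits]
  omega

theorem fst_id : PolyTime A (fun x : α × β => x.1) := by
  refine ⟨.pop Stk.data fun _ => swap ;; drop, 20 * .X + 21, fun (x, y) => ⟨?_, fun i d => ?_⟩⟩
  · simp [csize_prod]; omega
  · rw [bits_prod]
    refine Runs.mono (Runs.pop_data ((runs_swap _ _).seq (runs_drop _))) ?_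
    simp [csize, Code.enc, BTree.size]; omega

theorem snd_id : PolyTime A (fun x : α × β => x.2) := by
  refine ⟨.pop Stk.data fun _ => drop, 20 * .X + 21, fun (x, y) => ⟨?_, fun i d => ?_⟩⟩
  · simp [csize_prod]; omega
  · rw [bits_prod]
    refine Runs.mono (Runs.pop_data (runs_drop _)) ?_
    simp [csize, Code.enc, BTree.size]; omega

theorem fst {f : α → β × γ} (hf : PolyTime A f) : PolyTime A (fun x => (f x).1) :=
  fst_id.comp hf

theorem snd {f : α → β × γ} (hf : PolyTime A f) : PolyTime A (fun x => (f x).2) :=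
  snd_id.comp hf

/-- A nonempty list and the pair of its head and tail are coded by the same tree. -/
theorem cons {f : α → β} {g : α → List β} (hf : PolyTime A f) (hg : PolyTime A g) :
    PolyTime A (fun x => f x :: g x) :=
  pair hf hg

theorem tail_id : PolyTime A (fun l : List α => l.tail) := by
  refine ⟨.pop Stk.data fun o : Option Bool => if o = some true then drop
    else .push Stk.data false, 10 * .X + 12, fun l => ⟨?_, fun i d => ?_⟩⟩
  · have := csize_tail_le l; simp; omega
  · cases l with
    | nil => exact Runs.mono (Runs.pop_data (x := false) (Runs.push_data _)) (by simp)
    | cons a l =>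
      rw [bits_cons]
      refine Runs.mono (Runs.pop_data (runs_drop _)) ?_
      simp [csize, Code.enc, encList, BTree.size]; omega

theorem tail {f : α → List β} (hf : PolyTime A f) : PolyTime A (fun x => (f x).tail) :=
  tail_id.comp hf

theorem headD_id (a₀ : α) : PolyTime A (fun l : List α => l.headD a₀) := by
  refine ⟨.pop Stk.data fun o : Option Bool => if o = some true then swap ;; drop
    else pushBits (Code.enc a₀).bits, 30 * .X + 22 + .C (csize a₀), fun l => ⟨?_, fun i d => ?_⟩⟩
  · cases l <;> simp; omega
  · cases l with
    | nil =>
      refine Runs.mono (Runs.pop_data (x := false) (runs_pushBits _)) ?_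
      simp [csize, BTree.length_bits]; omega
    | cons a l =>
      rw [bits_cons]
      refine Runs.mono (Runs.pop_data ((runs_swap _ _).seq (runs_drop _))) ?_
      simp [csize, Code.enc, encList, BTree.size]; omega

theorem headD {f : α → List β} (hf : PolyTime A f) (b : β) : PolyTime A (fun x => (f x).headD b) :=
  (headD_id b).comp hf

theorem cond {b : α → Bool} {f g : α → β} (hb : PolyTime A b) (hf : PolyTime A f)
    (hg : PolyTime A g) : PolyTime A (fun x => cond (b x) (f x) (g x)) := by
  obtain ⟨c₀, r, h₀⟩ := hb
  obtain ⟨c, p, hc⟩ := hf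
  obtain ⟨d, q, hd⟩ := hg
  -- The code of `true` is a node with two leaves, so two further bits have to be removed; the code
  -- of `false` is a single bit.
  refine ⟨dup ;; c₀ ;; .pop Stk.data fun o : Option Bool => if o = some true then
    .pop Stk.data (fun _ => .pop Stk.data (fun _ => c)) else d, 20 * .X + 13 + r + p + q,
    fun x => ⟨?_, fun i s => ?_⟩⟩
  · have h₁ := (hc x).1
    have h₂ := (hd x).1
    cases h : b x <;> simp [h] <;> omega
  · have h := (h₀ x).2
    refine ((runs_dup _).seq ((h _ _).seq (T' := 3 + p.eval (csize x) + q.eval (csize x))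
      ?_)).mono ?_
    · beta_reduce
      cases b x
      · refine Runs.mono (Runs.pop_data (x := false) (T := q.eval (csize x)) ?_) (by omega)
        exact (hd x).2 _ _
      · refine Runs.mono (Runs.pop_data (x := true) (T := p.eval (csize x) + 2) ?_) (by omega)
        exact Runs.pop_data (x := false) (Runs.pop_data (x := false) ((hc x).2 _ _))
    · simp [csize]; omega

theorem eq [DecidableEq β] {f g : α → β} (hf : PolyTime A f) (hg : PolyTime A g) :
    PolyTime A (fun x => decide (f x = g x)) := by
  have h : PolyTime A (fun x : β × β => decide (x.1 = x.2)) := by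
    classical
    refine ⟨.pop Stk.data fun _ => eqTest, 20 * .X + 21, fun (x, y) => ⟨?_, fun i d => ?_⟩⟩
    · have := csize_bool_le (decide (x = y)); simp; omega
    · have h := runs_eqTest (A := A) (i := i) (d := d) (Code.enc x) (Code.enc y)
      simp only [Code.enc_injective.eq_iff] at h
      rw [bits_prod]
      refine Runs.mono (Runs.pop_data (T := 20 * csize (x, y) + 20) ?_) (by simp)
      exact h.mono (by rw [csize_mk, csize, csize]; omega)
  exact h.comp (hf.pair hg)

/-- The program that pops a bit from the data stack and puts a mark on `c` if it is `true`. -/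
def testCons : Cmd (Sym A) :=
  .pop Stk.data fun o : Option Bool => if o = some true then .push Stk.c true else .skip

/-- The loop that consumes a list on top of the data stack by the given program. -/
def foldLoop (c : Cmd (Sym A)) : Cmd (Sym A) :=
  .loop Stk.c fun _ => .push Stk.data true ;; .push Stk.data true ;; c ;;
    .pop Stk.data fun _ => testCons

/-- The first bit of the list tells whether an element remains, and `testCons` turns it into a mark
on `c`. The loop consumes the mark, so `c` is empty while the step program runs. The two pushed bits
assemble the adjacent trees of `a`, `l`, `b` into `((a, l), b)`. The invariant `I` provides the
uniform time bound `N`. The stacks `S` are those between the test and the loop. -/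
theorem runs_foldLoop {s : β → α → β} {c : Cmd (Sym A)} {N : ℕ} (I : List α → β → Prop)
    (hI : ∀ a l b, I (a :: l) b → I l (s b a) ∧ ∀ i d,
      Runs c (conf i ((Code.enc ((a, l), b)).bits ++ d) [] [] [])
        (conf i ((Code.enc (l, s b a)).bits ++ d) [] [] []) N)
    (l : List α) (b : β) (hb : I l b) (i : List A) (d : List Bool) :
    ∃ S, Runs testCons (conf i ((Code.enc l).bits ++ ((Code.enc b).bits ++ d)) [] [] []) S 2 ∧
      Runs (foldLoop c) S (conf i ((Code.enc (l.foldl s b)).bits ++ d) [] [] [])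
        (l.length * (N + 6) + 1) := by
  induction l generalizing b with
  | nil =>
    refine ⟨conf i ((Code.enc b).bits ++ d) [] [] [], ?_, Runs.mono (Runs.loop_nil rfl) (by simp)⟩
    exact Runs.pop_data (x := false) Runs.skip
  | cons a l ih =>
    obtain ⟨h₁, h₂⟩ := hI a l b hb
    obtain ⟨S, hS, hS'⟩ := ih _ h₁
    refine ⟨conf i ((Code.enc a).bits ++ ((Code.enc l).bits ++ ((Code.enc b).bits ++ d))) [] []
      [true], ?_, ?_⟩
    · rw [bits_cons]
      exact Runs.pop_data (x := true) (Runs.push_c _)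
    · specialize h₂ i d
      rw [bits_prod, bits_prod, bits_prod] at h₂
      refine Runs.mono (Runs.loop_c ((Runs.push_data _).seq ((Runs.push_data _).seq
        (h₂.seq (Runs.pop_data hS)))) hS') ?_
      simp only [List.length_cons, Nat.add_mul, one_mul]
      omega

/-- Folding over a list is in polynomial time if every step is, and if the size of the accumulator
grows in every step by at most a polynomial in the size of the input. -/
theorem foldl {f : γ → List α} {init : γ → β} {step : γ × β × α → β} (hf : PolyTime A f)
    (hinit : PolyTime A init) (hstep : PolyTime A step) (I : γ → β → Prop) (q : Polynomial ℕ)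
    (h₀ : ∀ x, I x (init x))
    (hI : ∀ x b a, I x b → a ∈ f x →
      I x (step (x, b, a)) ∧ csize (step (x, b, a)) ≤ csize b + q.eval (csize x)) :
    PolyTime A (fun x => (f x).foldl (fun b a => step (x, b, a)) (init x)) := by
  have hG : PolyTime A (fun z : (α × List α) × (γ × β) =>
      (z.1.2, (z.2.1, step (z.2.1, z.2.2, z.1.1)))) :=
    id.fst.snd.pair (id.snd.fst.pair (hstep.comp (id.snd.fst.pair (id.snd.snd.pair id.fst.fst))))
  obtain ⟨c, pG, hG⟩ := hG
  obtain ⟨e, pE, hE⟩ := hf.pair ((id (α := γ)).pair hinit)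
  obtain ⟨_, pf, hf⟩ := hf
  obtain ⟨_, pi, hinit⟩ := hinit
  obtain ⟨g, pg, hg⟩ := snd_id (A := A) (α := γ) (β := β)
  -- `B` bounds every accumulator: the initial size plus growth `q` for each of at most `pf`
  -- elements.
  obtain ⟨B, hBdef⟩ : ∃ B : Polynomial ℕ, B = pi + pf * q := ⟨_, rfl⟩
  refine ⟨e ;; .pop Stk.data (fun _ => testCons) ;; foldLoop c ;; g,
    pE + 3 + (pf * (pG.comp (pf + .X + B + 5) + 6) + 1) + pg.comp (.X + B + 1) + B,
    fun x => ?_⟩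
  let s : γ × β → α → γ × β := fun z a => (z.1, step (z.1, z.2, a))
  have hs : ∀ (l : List α) (b : β),
      l.foldl s (x, b) = (x, l.foldl (fun b a => step (x, b, a)) b) := by
    intro l
    induction l with
    | nil => simp
    | cons a l ih => intro b; simp [s, ih]
  have hfin : ∀ (l : List α) (b : β), I x b → l ⊆ f x →
      csize (l.foldl (fun b a => step (x, b, a)) b) ≤ csize b + l.length * q.eval (csize x) := by
    intro l
    induction l with
    | nil => simp
    | cons a l ih =>
      intro b hb hl
      obtain ⟨h₁, h₂⟩ := hI x b a hb (hl (by simp))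
      have := ih _ h₁ (fun y hy => hl (by simp [hy]))
      simp only [List.foldl_cons, List.length_cons, Nat.add_mul, one_mul]
      omega
  have hlen : (f x).length ≤ pf.eval (csize x) := (length_le_csize _).trans (hf x).1
  have hB : csize (init x) + (f x).length * q.eval (csize x) ≤ B.eval (csize x) := by
    simp only [hBdef, Polynomial.eval_add, Polynomial.eval_mul]
    exact Nat.add_le_add (hinit x).1 (Nat.mul_le_mul_right _ hlen)
  have hres := (hfin (f x) (init x) (h₀ x) (List.Subset.refl _)).trans hB
  refine ⟨?_, fun i d => ?_⟩
  · refine hres.trans ?_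
    rw [Polynomial.eval_add]
    omega
  · obtain ⟨S, hS, hS'⟩ := runs_foldLoop (A := A) (s := s) (c := c)
      (N := pG.eval (pf.eval (csize x) + csize x + B.eval (csize x) + 5))
      -- The last clause is a potential: the current size plus the growth that the remaining
      -- elements may still cause never increases.
      (fun l z => z.1 = x ∧ I x z.2 ∧ l ⊆ f x ∧ csize l ≤ pf.eval (csize x) ∧
        csize z.2 + l.length * q.eval (csize x) ≤ B.eval (csize x)) (by
          rintro a l ⟨z, b⟩ ⟨hz, hb, hl, hl', hl''⟩
          dsimp only at hz
          subst hz
          obtain ⟨h₁, h₂⟩ := hI z b a hb (hl (by simp))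
          simp only [csize_cons, List.length_cons, Nat.add_mul, one_mul] at hl' hl''
          refine ⟨⟨rfl, h₁, fun y hy => hl (by simp [hy]), by omega, by simp only [s]; omega⟩,
            fun i d => ((hG ((a, l), (z, b))).2 i d).mono (eval_mono _ ?_)⟩
          simp only [csize_mk]
          omega) (f x) (x, init x) ⟨rfl, h₀ x, List.Subset.refl _, (hf x).1, hB⟩ i d
    have h₁ := (hE x).2 i d
    rw [bits_prod] at h₁
    have h₂ := (hg (x, (f x).foldl (fun b a => step (x, b, a)) (init x))).2 i d
    rw [hs] at hS'
    refine Runs.mono (h₁.seq (Runs.seq (Runs.pop_data hS) (hS'.seq h₂))) ?_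
    have h₃ : pg.eval (csize (x, (f x).foldl (fun b a => step (x, b, a)) (init x))) ≤
        pg.eval (csize x + B.eval (csize x) + 1) := eval_mono _ (by rw [csize_mk]; omega)
    have h₄ := Nat.mul_le_mul_right
      (pG.eval (pf.eval (csize x) + csize x + B.eval (csize x) + 5) + 6) hlen
    simp only [Polynomial.eval_add, Polynomial.eval_mul, Polynomial.eval_comp, Polynomial.eval_X,
      Polynomial.eval_ofNat, Polynomial.eval_one]
    omega

end PolyTime

end StackProgram

/-! ### List operations in polynomial time. -/

namespace StackProgram

/-- The nonempty suffixes of a list, the shortest one first. -/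
def properTails {α : Type} (l : List α) : List (List α) :=
  (l.foldl (fun (z : List α × List (List α)) _ => (z.1.tail, z.1 :: z.2)) (l, [])).2

theorem mem_properTails {α : Type} {l m : List α} : m ∈ properTails l ↔ m ≠ [] ∧ m <:+ l := by
  -- The list `k` that is folded over only counts the steps, so it is separated from the list `l`
  -- that is shortened.
  have : ∀ (k l : List α) (acc : List (List α)), k.length = l.length →
      (m ∈ (k.foldl (fun (z : List α × List (List α)) _ => (z.1.tail, z.1 :: z.2)) (l, acc)).2 ↔
        m ∈ acc ∨ m ≠ [] ∧ m <:+ l) := by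
    intro k
    induction k with
    | nil =>
      intro l acc h
      obtain rfl := List.length_eq_zero_iff.1 h.symm
      simp
    | cons a k ih =>
      intro l acc h
      cases l with
      | nil => simp at h
      | cons b l =>
        rw [List.foldl_cons, ih _ _ (by simpa using h), List.suffix_cons_iff]
        simp only [List.tail_cons, List.mem_cons]
        constructor
        · rintro ((rfl | h) | h)
          · exact .inr ⟨by simp, .inl rfl⟩
          · exact .inl h
          · exact .inr ⟨h.1, .inr h.2⟩
        · rintro (h | ⟨h, rfl | h'⟩)
          · exact .inl (.inr h)
          · exact .inl (.inl rfl)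
          · exact .inr ⟨h, h'⟩
  simpa [properTails] using this l l [] rfl

namespace PolyTime

variable {A α β γ δ : Type} [Code α] [Code β] [Code γ] [Code δ]

theorem congr {f g : α → β} (hf : PolyTime A f) (h : ∀ x, f x = g x) : PolyTime A g :=
  funext h ▸ hf

theorem exists_csize_le {f : α → β} (hf : PolyTime A f) :
    ∃ q : Polynomial ℕ, ∀ x, csize (f x) ≤ q.eval (csize x) :=
  let ⟨_, q, h⟩ := hf
  ⟨q, fun x => (h x).1⟩

theorem exists_csize_le_of_mem {f : γ → List α} {g : γ × α → β} (hf : PolyTime A f)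
    (hg : PolyTime A g) :
    ∃ q : Polynomial ℕ, ∀ x, ∀ a ∈ f x, csize (g (x, a)) ≤ q.eval (csize x) := by
  obtain ⟨p, hp⟩ := hf.exists_csize_le
  obtain ⟨q, hq⟩ := hg.exists_csize_le
  refine ⟨q.comp (.X + p + 1), fun x a ha => (hq _).trans ?_⟩
  rw [Polynomial.eval_comp]
  refine eval_mono _ ?_
  have := (csize_le_of_mem ha).trans (hp x)
  simp [csize_mk]
  omega

theorem not {f : α → Bool} (hf : PolyTime A f) : PolyTime A (fun x => !f x) :=
  (cond hf (const false) (const true)).congr fun x => by cases f x <;> rfl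

theorem and {f g : α → Bool} (hf : PolyTime A f) (hg : PolyTime A g) :
    PolyTime A (fun x => f x && g x) :=
  (cond hf hg (const false)).congr fun x => by cases f x <;> rfl

theorem or {f g : α → Bool} (hf : PolyTime A f) (hg : PolyTime A g) :
    PolyTime A (fun x => f x || g x) :=
  (cond hf (const true) hg).congr fun x => by cases f x <;> rfl

theorem foldl_cons {f : γ → List α} {init : γ → List β} {g : γ × α → β} (hf : PolyTime A f)
    (hinit : PolyTime A init) (hg : PolyTime A g) :
    PolyTime A (fun x => (f x).foldl (fun b a => g (x, a) :: b) (init x)) := by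
  obtain ⟨q, hq⟩ := exists_csize_le_of_mem hf hg
  refine foldl (step := fun z : γ × List β × α => g (z.1, z.2.2) :: z.2.1) hf hinit
    ((hg.comp (id.fst.pair id.snd.snd)).cons id.snd.fst) (fun _ _ => True) (q + 1)
    (fun _ => trivial) fun x b a _ ha => ⟨trivial, ?_⟩
  have := hq x a ha
  simp
  omega

theorem reverse {f : γ → List α} (hf : PolyTime A f) : PolyTime A (fun x => (f x).reverse) :=
  (foldl_cons (g := fun z : γ × α => z.2) hf (const []) id.snd).congr fun x => by
    simp

theorem append {f g : γ → List α} (hf : PolyTime A f) (hg : PolyTime A g) :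
    PolyTime A (fun x => f x ++ g x) :=
  (foldl_cons (g := fun z : γ × α => z.2) hf.reverse hg id.snd).congr fun x => by
    simp

theorem map {f : γ → List α} {g : γ × α → β} (hf : PolyTime A f) (hg : PolyTime A g) :
    PolyTime A (fun x => (f x).map fun a => g (x, a)) :=
  (foldl_cons hf.reverse (const []) hg).congr fun x => by
    rw [List.foldl_reverse, List.map_eq_foldr]

theorem flatMap {f : γ → List α} {g : γ × α → List β} (hf : PolyTime A f) (hg : PolyTime A g) :
    PolyTime A (fun x => (f x).flatMap fun a => g (x, a)) := by
  obtain ⟨q, hq⟩ := exists_csize_le_of_mem hf.reverse hg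
  refine (foldl (step := fun z : γ × List β × α => g (z.1, z.2.2) ++ z.2.1) hf.reverse (const [])
    ((hg.comp (id.fst.pair id.snd.snd)).append id.snd.fst) (fun _ _ => True) q
    (fun _ => trivial) fun x b a _ ha => ⟨trivial, ?_⟩).congr fun x => ?_
  · have := hq x a ha
    have := csize_append (g (x, a)) b
    dsimp only
    omega
  · rw [List.foldl_reverse]
    induction f x with
    | nil => rfl
    | cons a l ih => simp [ih]

theorem any {f : γ → List α} {g : γ × α → Bool} (hf : PolyTime A f) (hg : PolyTime A g) :
    PolyTime A (fun x => (f x).any fun a => g (x, a)) := by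
  refine (foldl (step := fun z : γ × Bool × α => z.2.1 || g (z.1, z.2.2)) hf (const false)
    (id.snd.fst.or (hg.comp (id.fst.pair id.snd.snd))) (fun _ _ => True) 3
    (fun _ => trivial) fun x b a _ ha => ⟨trivial, ?_⟩).congr fun x => ?_
  · have := csize_bool_le (b || g (x, a))
    simp
    omega
  · have : ∀ (l : List α) (b : Bool), l.foldl (fun b a => b || g (x, a)) b =
        (b || l.any fun a => g (x, a)) := by
      intro l
      induction l with
      | nil => simp
      | cons a l ih => intro b; simp [ih, Bool.or_assoc]
    simpa using this (f x) false

theorem all {f : γ → List α} {g : γ × α → Bool} (hf : PolyTime A f) (hg : PolyTime A g) :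
    PolyTime A (fun x => (f x).all fun a => g (x, a)) :=
  (any hf hg.not).not.congr fun x => by simp [List.all_eq_not_any_not]

theorem filter {f : γ → List α} {g : γ × α → Bool} (hf : PolyTime A f) (hg : PolyTime A g) :
    PolyTime A (fun x => (f x).filter fun a => g (x, a)) :=
  (flatMap (g := fun z => bif g z then [z.2] else []) hf
    (cond hg (id.snd.cons (const [])) (const []))).congr fun x => by
      induction f x with
      | nil => rfl
      | cons a l ih => cases h : g (x, a) <;> simp [h, ih]

/-- A table lookup: nested case distinctions over the elements of `α`. If `β` is empty then so is
`α`, and any program will do. -/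
theorem of_finite [Finite α] (f : α → β) : PolyTime A f := by
  classical
  have key : ∀ l : List α, ∃ g : α → β, PolyTime A g ∧ ∀ a ∈ l, g a = f a := by
    intro l
    induction l with
    | nil =>
      cases isEmpty_or_nonempty β with
      | inl h => exact ⟨f, ⟨.skip, 0, fun x => h.elim (f x)⟩, by simp⟩
      | inr h => exact ⟨_, const h.some, by simp⟩
    | cons a l ih =>
      obtain ⟨g, hg, h⟩ := ih
      refine ⟨_, cond (eq id (const a)) (const (f a)) hg, fun b hb => ?_⟩
      by_cases hba : b = a
      · simp [hba]
      · simpa [hba] using h b ((List.mem_cons.1 hb).resolve_left hba)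
  obtain ⟨l, hl⟩ : ∃ l : List α, ∀ a, a ∈ l := by
    cases nonempty_fintype α
    exact ⟨Finset.univ.toList, by simp⟩
  obtain ⟨g, hg, h⟩ := key l
  exact hg.congr fun a => h a (hl a)

/-- Applying a function repeatedly, once for every element of a list. -/
theorem iterate {f : γ → List α} {init : γ → β} {g : γ × β → β} (hf : PolyTime A f)
    (hinit : PolyTime A init) (hg : PolyTime A g) (q : Polynomial ℕ)
    (hq : ∀ x b, csize (g (x, b)) ≤ csize b + q.eval (csize x)) :
    PolyTime A (fun x => (fun b => g (x, b))^[(f x).length] (init x)) :=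
  (foldl (step := fun z : γ × β × α => g (z.1, z.2.1)) hf hinit
    (hg.comp (id.fst.pair id.snd.fst)) (fun _ _ => True) q (fun _ => trivial)
    fun x b a _ _ => ⟨trivial, hq x b⟩).congr fun x => by
      exact List.foldl_const (fun b => g (x, b)) (init x) (f x)

theorem isPrefixOf [DecidableEq α] {f g : γ → List α} (hf : PolyTime A f) (hg : PolyTime A g) :
    PolyTime A (fun x => (f x).isPrefixOf (g x)) := by
  -- The accumulator holds a flag and the unread part of the second word. Comparing that part with
  -- `a` put before its own tail tests that it begins with `a`, and fails on the empty word.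
  refine (foldl
    (step := fun z : γ × (Bool × List α) × α =>
      (z.2.1.1 && decide (z.2.1.2 = z.2.2 :: z.2.1.2.tail), z.2.1.2.tail))
    hf ((const true).pair hg)
    ((id.snd.fst.fst.and (eq id.snd.fst.snd (id.snd.snd.cons id.snd.fst.snd.tail))).pair
      id.snd.fst.snd.tail) (fun _ _ => True) 3
    (fun _ => trivial) fun x b a _ _ => ⟨trivial, ?_⟩).fst.congr fun x => ?_
  · have h₁ := csize_bool_le (b.1 && decide (b.2 = a :: b.2.tail))
    have h₂ := csize_tail_le b.2
    rw [csize_mk, csize_prod b]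
    simp
    omega
  · have : ∀ (l m : List α) (b : Bool), (l.foldl (fun (z : Bool × List α) a =>
        (z.1 && decide (z.2 = a :: z.2.tail), z.2.tail)) (b, m)).1 = (b && l.isPrefixOf m) := by
      intro l
      induction l with
      | nil => simp
      | cons a l ih =>
        intro m b
        rw [List.foldl_cons, ih]
        cases m with
        | nil => simp
        | cons c m =>
          by_cases h : c = a
          · simp [h]
          · simp [h, List.isPrefixOf, Ne.symm h]
    simpa using this (f x) (g x) true

theorem properTails {f : γ → List α} (hf : PolyTime A f) :
    PolyTime A (fun x => StackProgram.properTails (f x)) := by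
  obtain ⟨q, hq⟩ := hf.exists_csize_le
  -- Each step adds the current suffix to the output. The invariant bounds that suffix by the size
  -- of the whole list, so the growth per step stays polynomial.
  refine (foldl (step := fun z : γ × (List α × List (List α)) × α =>
    (z.2.1.1.tail, z.2.1.1 :: z.2.1.2)) hf (hf.pair (const []))
    (id.snd.fst.fst.tail.pair (id.snd.fst.fst.cons id.snd.fst.snd))
    (fun x b => csize b.1 ≤ q.eval (csize x)) (q + 1) hq fun x b a hb _ => ⟨?_, ?_⟩).snd
  · exact (csize_tail_le _).trans hb
  · have := csize_tail_le b.1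
    rw [csize_mk, csize_prod b, csize_cons]
    simp
    omega

end PolyTime

end StackProgram

/-! ### The decision procedure and its running time. -/

namespace ForbiddenDifference

open StackProgram

/-- One step of reading a list of patterns from right to left. -/
def parseStep (L : List Pattern) (a : Option SignType) : List Pattern :=
  bif decide (a = none) then [] :: L else (a.getD 0 :: L.headD []) :: L.tail

/-- Read from the right, the separator of a pattern comes before its letters and opens an empty word
to which they are prepended. The defaults in `parseStep` are therefore never used on an encoding. -/
theorem foldl_parseStep (L : List Pattern) :
    (encodePatterns L).reverse.foldl parseStep [] = L := by
  rw [List.foldl_reverse]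
  have : ∀ (w : Pattern) (L : List Pattern) (v : Pattern),
      (w.map some).foldr (fun a L => parseStep L a) (v :: L) = (w ++ v) :: L := by
    intro w L v
    induction w with
    | nil => rfl
    | cons a w ih =>
      rw [List.map_cons, List.foldr_cons, ih]
      simp [parseStep]
  induction L with
  | nil => rfl
  | cons w L ih =>
    rw [encodePatterns, List.flatMap_cons, List.foldr_append, ← encodePatterns, ih,
      List.foldr_append]
    simpa [parseStep] using this w L []

/-- The patterns and their negatives, read from right to left. -/
def reversedPatterns (L : List Pattern) : List Pattern :=
  L.map List.reverse ++ L.map fun d => (d.map Neg.neg).reverse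

/-- The suffixes of the words of `R`. -/
def states (R : List Pattern) : List Pattern := [] :: R.flatMap fun d => properTails d

/-- A word of zeros that is at least as long as all the words of `L`. -/
def zeros (L : List Pattern) : Pattern := L.flatMap fun d => d.map fun _ => 0

/-- No word of `R` is a prefix of `x`. -/
def isValid (R : List Pattern) (x : Pattern) : Bool := R.all fun d => !d.isPrefixOf x

/-- The word `q` is a prefix of `x` that extends all the words of `Q` that are prefixes of `x`. -/
def isState (Q : List Pattern) (x q : Pattern) : Bool :=
  q.isPrefixOf x && Q.all fun r => !r.isPrefixOf x || r.isPrefixOf q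

/-- The states that equal a state of `S` or follow one after a valid letter. -/
def nextStates (R Q S : List Pattern) : List Pattern :=
  Q.filter fun q => S.any fun p => decide (p = q) ||
    [-1, 0, 1].any fun a => isValid R (a :: p) && isState Q (a :: p) q

/-- The states that can be reached from the states for `x`. -/
def reachableStates (R Q : List Pattern) (x : Pattern) : List Pattern :=
  (nextStates R Q)^[Q.length] (Q.filter fun q => isState Q x q)

/-- The test whether the state for the word `z` can be reached from the state for `1 :: z`. -/
def hasCycle (R : List Pattern) (z : Pattern) : Bool :=
  isValid R z && isValid R (1 :: z) &&
    (reachableStates R (states R) (1 :: z)).any fun q => isState (states R) z q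

/-- The test for positive capacity. -/
def positiveCapacityTest (L : List Pattern) : Bool := hasCycle (reversedPatterns L) (zeros L)

section PolyTime

variable {A γ : Type} [Code γ]

theorem polyTime_parse {f : γ → List (Option SignType)} (hf : PolyTime A f) :
    PolyTime A (fun x => (f x).foldl parseStep []) := by
  refine PolyTime.foldl (step := fun z : γ × List Pattern × Option SignType =>
      parseStep z.2.1 z.2.2)
    hf (.const []) ?_ (fun _ _ => True) 10 (fun _ => trivial) fun x b a _ _ => ⟨trivial, ?_⟩
  · exact .cond (.eq PolyTime.id.snd.snd (.const none)) (.cons (.const []) PolyTime.id.snd.fst)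
      (.cons (.cons ((PolyTime.of_finite fun a : Option SignType => a.getD 0).comp
        PolyTime.id.snd.snd) (PolyTime.id.snd.fst.headD [])) PolyTime.id.snd.fst.tail)
  -- The growth bound 10 covers a letter, of size at most 5, and the new nodes and leaves of the
  -- list.
  · have h : ∀ a : SignType, csize a ≤ 5 := fun a => by cases a <;> decide
    cases a with
    | none => simp [parseStep]; omega
    | some a =>
      have := h a
      cases b <;> simp [parseStep] <;> omega

theorem polyTime_reversedPatterns {f : γ → List Pattern} (hf : PolyTime A f) :
    PolyTime A (fun x => reversedPatterns (f x)) :=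
  .append (.map (g := fun z : γ × Pattern => z.2.reverse) hf PolyTime.id.snd.reverse)
    (.map (g := fun z : γ × Pattern => (z.2.map Neg.neg).reverse) hf
      (.reverse (.map (g := fun z : (γ × Pattern) × SignType => -z.2) PolyTime.id.snd
        ((PolyTime.of_finite fun a : SignType => -a).comp PolyTime.id.snd))))

theorem polyTime_states {R : γ → List Pattern} (hR : PolyTime A R) :
    PolyTime A (fun x => states (R x)) :=
  .cons (.const []) (.flatMap (g := fun z : γ × Pattern => properTails z.2) hR
    PolyTime.id.snd.properTails)

theorem polyTime_zeros {f : γ → List Pattern} (hf : PolyTime A f) :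
    PolyTime A (fun x => zeros (f x)) :=
  .flatMap (g := fun z : γ × Pattern => z.2.map fun _ => 0) hf
    (.map (g := fun _ : (γ × Pattern) × SignType => (0 : SignType)) PolyTime.id.snd (.const 0))

theorem polyTime_isValid {R : γ → List Pattern} {x : γ → Pattern} (hR : PolyTime A R)
    (hx : PolyTime A x) : PolyTime A (fun c => isValid (R c) (x c)) :=
  .all (g := fun z : γ × Pattern => !z.2.isPrefixOf (x z.1)) hR
    (.not (.isPrefixOf PolyTime.id.snd (hx.comp PolyTime.id.fst)))

theorem polyTime_isState {Q : γ → List Pattern} {x q : γ → Pattern} (hQ : PolyTime A Q)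
    (hx : PolyTime A x) (hq : PolyTime A q) : PolyTime A (fun c => isState (Q c) (x c) (q c)) :=
  .and (.isPrefixOf hq hx)
    (.all (g := fun z : γ × Pattern => !z.2.isPrefixOf (x z.1) || z.2.isPrefixOf (q z.1)) hQ
      (.or (.not (.isPrefixOf PolyTime.id.snd (hx.comp PolyTime.id.fst)))
        (.isPrefixOf PolyTime.id.snd (hq.comp PolyTime.id.fst))))

theorem polyTime_nextStates {R Q S : γ → List Pattern} (hR : PolyTime A R) (hQ : PolyTime A Q)
    (hS : PolyTime A S) : PolyTime A (fun c => nextStates (R c) (Q c) (S c)) := by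
  let F := (γ × Pattern) × Pattern
  have hp : PolyTime A (fun z : F × SignType => z.2 :: z.1.2) :=
    .cons PolyTime.id.snd PolyTime.id.fst.snd
  exact .filter
    (g := fun z : γ × Pattern => (S z.1).any fun p => decide (p = z.2) ||
      [-1, 0, 1].any fun a => isValid (R z.1) (a :: p) && isState (Q z.1) (a :: p) z.2)
    hQ (.any
      (g := fun z : F => decide (z.2 = z.1.2) || [-1, 0, 1].any fun a =>
        isValid (R z.1.1) (a :: z.2) && isState (Q z.1.1) (a :: z.2) z.1.2)
      (hS.comp PolyTime.id.fst) (.or (.eq PolyTime.id.snd PolyTime.id.fst.snd) (.any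
        (g := fun z : F × SignType => isValid (R z.1.1.1) (z.2 :: z.1.2) &&
          isState (Q z.1.1.1) (z.2 :: z.1.2) z.1.1.2)
        (.const [-1, 0, 1]) (.and (polyTime_isValid (hR.comp PolyTime.id.fst.fst.fst) hp)
          (polyTime_isState (hQ.comp PolyTime.id.fst.fst.fst) hp PolyTime.id.fst.fst.snd)))))

theorem polyTime_reachableStates {R Q : γ → List Pattern} {x : γ → Pattern} (hR : PolyTime A R)
    (hQ : PolyTime A Q) (hx : PolyTime A x) :
    PolyTime A (fun c => reachableStates (R c) (Q c) (x c)) := by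
  obtain ⟨q, hq⟩ := hQ.exists_csize_le
  exact .iterate (g := fun z : γ × List Pattern => nextStates (R z.1) (Q z.1) z.2) hQ
    (.filter (g := fun z : γ × Pattern => isState (Q z.1) (x z.1) z.2) hQ
      (polyTime_isState (hQ.comp PolyTime.id.fst) (hx.comp PolyTime.id.fst) PolyTime.id.snd))
    (polyTime_nextStates (hR.comp PolyTime.id.fst) (hQ.comp PolyTime.id.fst) PolyTime.id.snd) q
    -- Each round returns a sublist of `Q`, so the set of states stays small however often it is
    -- updated.
    fun c S => (csize_le_of_sublist List.filter_sublist).trans ((hq c).trans (by omega))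

theorem polyTime_hasCycle {R : γ → List Pattern} {z : γ → Pattern} (hR : PolyTime A R)
    (hz : PolyTime A z) : PolyTime A (fun c => hasCycle (R c) (z c)) :=
  have hQ := polyTime_states hR
  have h1z := PolyTime.cons (PolyTime.const 1) hz
  .and (.and (polyTime_isValid hR hz) (polyTime_isValid hR h1z))
    (.any (g := fun y : γ × Pattern => isState (states (R y.1)) (z y.1) y.2)
      (polyTime_reachableStates hR hQ h1z)
      (polyTime_isState (hQ.comp PolyTime.id.fst) (hz.comp PolyTime.id.fst) PolyTime.id.snd))

theorem polyTime_positiveCapacityTest {f : γ → List Pattern} (hf : PolyTime A f) :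
    PolyTime A (fun x => positiveCapacityTest (f x)) :=
  polyTime_hasCycle (polyTime_reversedPatterns hf) (polyTime_zeros hf)

end PolyTime

end ForbiddenDifference

/-! ### From stack programs to Turing machines with input and output. -/

namespace StackProgram

open Turing Computability

variable {A : Type}

/-- Move the input to the data stack, as the reversed list. -/
def readInput [Code A] : Cmd (Sym A) :=
  .push Stk.data false ;; .loop Stk.input fun a : A =>
    pushBits (Code.enc a).bits ;; .push Stk.data true

/-- Replace the tree for a truth value by the truth value itself. -/
def writeOutput : Cmd (Sym A) :=
  .pop Stk.data fun o : Option Bool => if o = some true then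
    .pop Stk.data fun _ => .pop Stk.data fun _ => .push Stk.data true else .push Stk.data false

theorem runs_readInput [Code A] {K : ℕ} (hK : ∀ a : A, csize a ≤ K) (l : List A) :
    Runs readInput (conf l [] [] [] []) (conf [] (Code.enc l.reverse).bits [] [] [])
      (l.length * (K + 3) + 2) := by
  have key : ∀ l m : List A,
      Runs (.loop Stk.input fun a : A => pushBits (Code.enc a).bits ;; .push Stk.data true)
        (conf l (Code.enc m).bits [] [] [])
        (conf [] (Code.enc (l.reverse ++ m)).bits [] [] []) (l.length * (K + 3) + 1) := by
    intro l
    induction l with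
    | nil => exact fun m => Runs.mono (Runs.loop_nil rfl) (by simp)
    | cons a l ih =>
      intro m
      specialize ih (a :: m)
      rw [List.reverse_cons, List.append_assoc, List.singleton_append]
      refine Runs.mono (Runs.loop_input ((runs_pushBits _).seq (Runs.push_data _)) ih) ?_
      have := hK a
      rw [BTree.length_bits, List.length_cons, Nat.add_mul]
      unfold csize at this
      omega
  have h := (Runs.push_data false).seq (key l [])
  rw [List.append_nil] at h
  exact h.mono (by omega)

theorem runs_writeOutput (b : Bool) :
    Runs (writeOutput (A := A)) (conf [] (Code.enc b).bits [] [] []) (conf [] [b] [] [] []) 4 := by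
  cases b
  · exact Runs.mono (Runs.pop_data (x := false) (T := 1) (Runs.push_data false)) (by omega)
  · exact Runs.pop_data (x := true) (T := 3)
      (Runs.pop_data (x := false) (Runs.pop_data (x := false) (Runs.push_data true)))

theorem csize_list_le [Code A] {K : ℕ} (hK : ∀ a : A, csize a ≤ K) (l : List A) :
    csize l ≤ l.length * (K + 1) + 1 := by
  induction l with
  | nil => simp
  | cons a l ih =>
    have := hK a
    rw [csize_cons, List.length_cons, Nat.add_mul]
    omega

/-- A test that is in polynomial time as a function of the reversed input string is computed by a
Turing machine in polynomial time. -/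
theorem PolyTime.computableInPolyTime [Fintype A] [Code A] {f : List A → Bool} (hf : PolyTime A f)
    {α : Type} (enc : α → List A) (g : α → Bool) (hg : ∀ a, f (enc a).reverse = g a) :
    Nonempty (TM2ComputableInPolyTime enc encodeBool g) := by
  obtain ⟨c, p, hc⟩ := hf
  obtain ⟨K, hK⟩ : ∃ K : ℕ, ∀ a : A, csize a ≤ K :=
    ⟨Finset.univ.sup csize, fun a => Finset.le_sup (f := csize) (Finset.mem_univ a)⟩
  let M := machine (readInput ;; c ;; writeOutput (A := A)) Stk.input Stk.data
  let time : Polynomial ℕ := .X * (.C K + 3) + 2 + (p.comp (.X * (.C K + 1) + 1) + 4) + 1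
  have key : ∀ a, Nonempty (TM2OutputsInTime M (enc a) (some [g a])
      (time.eval (enc a).length)) := by
    intro a
    have h₂ := (hc (enc a).reverse).2 [] []
    rw [List.append_nil, List.append_nil, hg] at h₂
    have h := (runs_readInput hK (enc a)).seq (h₂.seq (runs_writeOutput (g a)))
    have h₀ : (conf (enc a) [] [] [] [] : ∀ k, List (Sym A k)) =
        Function.update (β := fun k => List (Sym A k)) (fun _ => []) Stk.input (enc a) := by
      funext k; cases k <;> rfl
    have h₁ : (conf [] [g a] [] [] [] : ∀ k, List (Sym A k)) =
        Function.update (β := fun k => List (Sym A k)) (fun _ => []) Stk.data [g a] := by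
      funext k; cases k <;> rfl
    rw [h₀, h₁] at h
    have h' := h.mono (T' := (enc a).length * (K + 3) + 2 +
      (p.eval ((enc a).length * (K + 1) + 1) + 4)) (by
        have := eval_mono p (csize_list_le hK (enc a).reverse)
        rw [List.length_reverse] at this
        omega)
    have e : time.eval (enc a).length = (enc a).length * (K + 3) + 2 +
        (p.eval ((enc a).length * (K + 1) + 1) + 4) + 1 := by simp [time]
    rw [e]
    exact h'.outputsInTime
  exact ⟨{
    tm := M
    inputAlphabet := Equiv.refl A
    outputAlphabet := Equiv.refl Bool
    time := time
    -- The structure translates the input by the identity of the alphabet, which `List.map_id`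
    -- removes.
    outputsFun := fun a => cast (congrArg (fun l : List A =>
      TM2OutputsInTime M l (some [g a]) (time.eval (enc a).length)) (List.map_id _).symm)
      (key a).some }⟩

end StackProgram

/-! ### Correctness of the automaton search. -/

namespace ForbiddenDifference

open StackProgram

/-- The words `x` and `y` have the same prefixes in `Q`. -/
def SamePrefixes (Q : List Pattern) (x y : Pattern) : Prop := ∀ r ∈ Q, r <+: x ↔ r <+: y

section

variable {Q R : List Pattern} {x y z q : Pattern}

theorem SamePrefixes.symm (h : SamePrefixes Q x y) : SamePrefixes Q y x := fun r hr => (h r hr).symm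

theorem SamePrefixes.trans (h : SamePrefixes Q x y) (h' : SamePrefixes Q y z) :
    SamePrefixes Q x z := fun r hr => (h r hr).trans (h' r hr)

/-- This makes the automaton well defined: since `Q` is closed under removing the first letter, the
prefixes of `a :: x` in `Q` depend only on `a` and those of `x`. -/
theorem SamePrefixes.cons (hQ : ∀ a r, a :: r ∈ Q → r ∈ Q) (h : SamePrefixes Q x y)
    (a : SignType) : SamePrefixes Q (a :: x) (a :: y) := by
  rintro (_ | ⟨b, r⟩) hr
  · simp
  · rw [List.cons_prefix_cons, List.cons_prefix_cons, h r (hQ b r hr)]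

theorem samePrefixes_append (h : ∀ r ∈ Q, r.length ≤ x.length) (y : Pattern) :
    SamePrefixes Q x (x ++ y) := fun r hr =>
  ⟨fun hp => hp.trans (List.prefix_append x y), fun hp =>
    List.prefix_of_prefix_length_le hp (List.prefix_append x y) (h r hr)⟩

theorem isValid_iff : isValid R x = true ↔ ∀ d ∈ R, ¬ d <+: x := by
  simp only [isValid, List.all_eq_true, Bool.not_eq_true', ← Bool.not_eq_true,
    List.isPrefixOf_iff_prefix]

theorem SamePrefixes.isValid_iff (h : SamePrefixes Q x y) (hR : R ⊆ Q) :
    isValid R x = true ↔ isValid R y = true := by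
  rw [ForbiddenDifference.isValid_iff, ForbiddenDifference.isValid_iff]
  exact forall₂_congr fun d hd => not_congr (h d (hR hd))

theorem isState_iff (hq : q ∈ Q) : isState Q x q = true ↔ SamePrefixes Q x q := by
  simp only [isState, Bool.and_eq_true, List.all_eq_true, Bool.or_eq_true, Bool.not_eq_true',
    List.isPrefixOf_iff_prefix]
  constructor
  · rintro ⟨h₁, h₂⟩ r hr
    refine ⟨fun h => ?_, fun h => h.trans h₁⟩
    rcases h₂ r hr with h' | h'
    · exact absurd (List.isPrefixOf_iff_prefix.2 h) (by simp [h'])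
    · exact h'
  · intro h
    refine ⟨(h q hq).2 List.prefix_rfl, fun r hr => ?_⟩
    by_cases hx : r <+: x
    · exact .inr ((h r hr).1 hx)
    · exact .inl (by rw [← Bool.not_eq_true, List.isPrefixOf_iff_prefix]; exact hx)

/-- The longest prefix of `x` in `Q` serves, because of two prefixes of `x` the shorter is a prefix
of the longer. -/
theorem exists_samePrefixes (hQ : [] ∈ Q) (x : Pattern) : ∃ q ∈ Q, SamePrefixes Q x q := by
  classical
  obtain ⟨q, hq, hmax⟩ := (Q.toFinset.filter fun r => r <+: x).exists_max_image List.length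
    ⟨[], by simpa using hQ⟩
  simp only [Finset.mem_filter, List.mem_toFinset] at hq hmax
  exact ⟨q, hq.1, fun r hr => ⟨fun h => List.prefix_of_prefix_length_le h hq.2 (hmax r ⟨hr, h⟩),
    fun h => h.trans hq.2⟩⟩

theorem mem_states : q ∈ states R ↔ q = [] ∨ ∃ d ∈ R, q <:+ d := by
  simp only [states, List.mem_cons, List.mem_flatMap, mem_properTails]
  by_cases hq : q = [] <;> simp [hq]

theorem mem_nextStates {S : List Pattern} : q ∈ nextStates R Q S ↔
    q ∈ Q ∧ (q ∈ S ∨ ∃ p ∈ S, ∃ a, isValid R (a :: p) = true ∧ SamePrefixes Q (a :: p) q) := by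
  rw [nextStates, List.mem_filter]
  refine and_congr_right fun hq => ?_
  simp only [List.any_eq_true, Bool.or_eq_true, decide_eq_true_eq, Bool.and_eq_true, isState_iff hq]
  constructor
  · rintro ⟨p, hp, rfl | ⟨a, -, h⟩⟩
    · exact .inl hp
    · exact .inr ⟨p, hp, a, h⟩
  · rintro (h | ⟨p, hp, a, h⟩)
    · exact ⟨q, h, .inl rfl⟩
    · exact ⟨p, hp, .inr ⟨a, by cases a <;> decide, h⟩⟩

end

section reachable

variable {Q R : List Pattern} {x y z q : Pattern}

theorem iterate_nextStates_subset {S : List Pattern} (hS : S ⊆ Q) (n : ℕ) :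
    (nextStates R Q)^[n] S ⊆ Q := by
  cases n with
  | zero => exact hS
  | succ n =>
    rw [Function.iterate_succ_apply']
    exact fun q hq => (mem_nextStates.1 hq).1

/-- The iterates form an increasing chain of subsets of `Q` that is constant once two consecutive
sets agree, so it is stable after at most `Q.length` rounds. -/
theorem iterate_nextStates_subset_length {S : List Pattern} (hS : S ⊆ Q) (n : ℕ) :
    (nextStates R Q)^[n] S ⊆ (nextStates R Q)^[Q.length] S := by
  classical
  let T : ℕ → Finset Pattern := fun n => ((nextStates R Q)^[n] S).toFinset
  have hT : ∀ n, T (n + 1) = (nextStates R Q ((nextStates R Q)^[n] S)).toFinset := fun n => by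
    simp only [T, Function.iterate_succ_apply']
  have hmono : Monotone T := monotone_nat_of_le_succ fun n q hq => by
    rw [hT, List.mem_toFinset, mem_nextStates]
    have hq := List.mem_toFinset.1 hq
    exact ⟨iterate_nextStates_subset hS n hq, .inl hq⟩
  have hstab : ∀ m, (T m).card = (T (m + 1)).card → (T (m + 1)).card = (T (m + 2)).card := by
    intro m h
    have h := Finset.eq_of_subset_of_card_le (hmono (Nat.le_succ m)) h.ge
    have hmem : ∀ q, q ∈ (nextStates R Q)^[m] S ↔ q ∈ (nextStates R Q)^[m + 1] S := fun q => by
      rw [← List.mem_toFinset, ← List.mem_toFinset]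
      exact iff_of_eq (congrArg (q ∈ ·) h)
    refine congrArg _ (Finset.ext fun q => ?_)
    rw [hT, hT, List.mem_toFinset, List.mem_toFinset, mem_nextStates, mem_nextStates]
    simp only [hmem]
  have hbound : ∀ m, (T m).card ≤ Q.length := fun m =>
    (Finset.card_le_card (t := Q.toFinset) fun q hq =>
      List.mem_toFinset.2 (iterate_nextStates_subset hS m (List.mem_toFinset.1 hq))).trans
      (List.toFinset_card_le Q)
  suffices h : T n ⊆ T Q.length by
    exact fun q hq => List.mem_toFinset.1 (h (List.mem_toFinset.2 hq))
  rcases le_total n Q.length with h | h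
  · exact hmono h
  · have := Nat.stabilises_of_monotone (fun a b hab => Finset.card_le_card (hmono hab)) hbound
      hstab h
    exact (Finset.eq_of_subset_of_card_le (hmono h) this.le).ge

/-- A path in the automaton spells a word `x` put before `y`, letter by letter from the right;
validity is required after each letter of `x`, but not of `y` itself. -/
theorem mem_reachableStates (hQ : ∀ a r, a :: r ∈ Q → r ∈ Q) (hnil : [] ∈ Q) (hR : R ⊆ Q) :
    q ∈ reachableStates R Q y ↔ q ∈ Q ∧ ∃ x, SamePrefixes Q (x ++ y) q ∧
      ∀ a s, a :: s <:+ x → isValid R (a :: s ++ y) = true := by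
  have hS : (Q.filter fun q => isState Q y q) ⊆ Q := List.filter_subset_self Q
  constructor
  · intro hq
    refine ⟨iterate_nextStates_subset hS _ hq, ?_⟩
    unfold reachableStates at hq
    generalize Q.length = n at hq
    induction n generalizing q with
    | zero =>
      obtain ⟨hq, h⟩ := List.mem_filter.1 hq
      exact ⟨[], (isState_iff hq).1 h, by simp⟩
    | succ n ih =>
      rw [Function.iterate_succ_apply', mem_nextStates] at hq
      obtain ⟨hqQ, hq | ⟨p, hp, a, hv, h⟩⟩ := hq
      · exact ih hq
      · obtain ⟨x, hx, hs⟩ := ih hp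
        have hax := hx.cons hQ a
        refine ⟨a :: x, hax.trans h, fun b s hbs => ?_⟩
        rcases List.suffix_cons_iff.1 hbs with heq | hbs
        · rw [heq]
          exact (hax.isValid_iff hR).2 hv
        · exact hs b s hbs
  · rintro ⟨hq, x, hx, hs⟩
    refine iterate_nextStates_subset_length hS x.length ?_
    induction x generalizing q with
    | nil => exact List.mem_filter.2 ⟨hq, (isState_iff hq).2 hx⟩
    | cons a x ih =>
      obtain ⟨p, hp, hxp⟩ := exists_samePrefixes hnil (x ++ y)
      rw [List.length_cons, Function.iterate_succ_apply', mem_nextStates]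
      have hax := hxp.cons hQ a
      refine ⟨hq, .inr ⟨p, ih hp hxp fun b s h => hs b s (h.trans (List.suffix_cons a x)), a,
        (hax.isValid_iff hR).1 (hs a x List.suffix_rfl), hax.symm.trans hx⟩⟩

theorem suffix_append_iff {α : Type*} {t a b : List α} :
    t <:+ a ++ b ↔ t <:+ b ∨ ∃ s, s <:+ a ∧ t = s ++ b := by
  constructor
  · rintro ⟨u, hu⟩
    obtain ⟨s, h₁, h₂⟩ | ⟨c, h₁, h₂⟩ := List.append_eq_append_iff.1 hu
    · exact .inr ⟨s, ⟨u, h₁.symm⟩, h₂⟩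
    · exact .inl ⟨c, h₂.symm⟩
  · rintro (h | ⟨s, ⟨u, rfl⟩, rfl⟩)
    · exact h.trans (List.suffix_append a b)
    · exact ⟨u, by rw [List.append_assoc]⟩

/-- A word avoids `R` iff each of its suffixes is valid, and the suffixes are the words met while it
is built from the right. The left block of zeros matches reaching the state of `0^n`, as no member
of `states R` is longer than `n`. -/
theorem hasCycle_iff {n : ℕ} (hn : ∀ d ∈ R, d.length ≤ n) :
    hasCycle R (List.replicate n 0) = true ↔ ∃ x, ∀ d ∈ R,
      ¬ d <:+: List.replicate n 0 ++ (x ++ 1 :: List.replicate n 0) := by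
  have hnil : [] ∈ states R := mem_states.2 (.inl rfl)
  have hQ : ∀ a r, a :: r ∈ states R → r ∈ states R := fun a r h => by
    obtain h | ⟨d, hd, h⟩ := mem_states.1 h
    · simp at h
    · exact mem_states.2 (.inr ⟨d, hd, (List.suffix_cons a r).trans h⟩)
  have hR : R ⊆ states R := fun d hd => mem_states.2 (.inr ⟨d, hd, List.suffix_rfl⟩)
  have hlen : ∀ r ∈ states R, r.length ≤ (List.replicate n (0 : SignType)).length := fun r h => by
    rw [List.length_replicate]
    obtain rfl | ⟨d, hd, h⟩ := mem_states.1 h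
    · simp
    · exact h.length_le.trans (hn d hd)
  simp only [hasCycle, Bool.and_eq_true, List.any_eq_true, mem_reachableStates hQ hnil hR]
  constructor
  · rintro ⟨⟨hz, h1z⟩, q, ⟨hq, x, hx, hs⟩, hqz⟩
    rw [isState_iff hq] at hqz
    have hxz := hx.trans hqz.symm
    -- In the state of `0^n`, prepending zeros changes nothing: `0^(n+1)` has the same state as
    -- `0^n`.
    have hpad : ∀ m, SamePrefixes (states R)
        (List.replicate m 0 ++ (x ++ 1 :: List.replicate n 0)) (List.replicate n 0) := by
      intro m
      induction m with
      | zero => exact hxz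
      | succ m ih =>
        refine (ih.cons hQ 0).trans ?_
        rw [← List.replicate_succ, List.replicate_succ']
        exact (samePrefixes_append hlen _).symm
    refine ⟨x, fun d hd hinf => ?_⟩
    -- The suffix `t` at which `d` occurs starts in the right zeros or at the `1`, inside `x`, or in
    -- the left zeros; validity comes from `hz` and `h1z`, from `hs`, and from `hpad`, respectively.
    obtain ⟨t, hdt, ht⟩ := List.infix_iff_prefix_suffix.1 hinf
    have hval : ∀ u, d <+: u → ¬ isValid R u = true := fun u hu h => isValid_iff.1 h d hd hu
    obtain ht | ⟨s, hs', rfl⟩ := suffix_append_iff.1 ht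
    · obtain ht | ⟨s, hs', rfl⟩ := suffix_append_iff.1 ht
      · obtain rfl | ht := List.suffix_cons_iff.1 ht
        · exact hval _ hdt h1z
        · obtain ⟨k, hk, rfl⟩ := List.sublist_replicate_iff.1 ht.sublist
          refine hval _ (hdt.trans ⟨List.replicate (n - k) 0, ?_⟩) hz
          rw [List.replicate_append_replicate, Nat.add_sub_cancel' hk]
      · cases s with
        | nil => exact hval _ hdt h1z
        | cons a s => exact hval _ hdt (hs a s hs')
    · obtain ⟨k, -, rfl⟩ := List.sublist_replicate_iff.1 hs'.sublist
      exact hval _ hdt (((hpad k).isValid_iff hR).2 hz)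
  · rintro ⟨x, hx⟩
    have hval : ∀ t, t <:+ List.replicate n 0 ++ (x ++ 1 :: List.replicate n 0) →
        isValid R t = true := fun t ht => isValid_iff.2 fun d hd hdt =>
      hx d hd (List.infix_iff_prefix_suffix.2 ⟨t, hdt, ht⟩)
    have h1 : 1 :: List.replicate n 0 <:+
        List.replicate n 0 ++ (x ++ 1 :: List.replicate n (0 : SignType)) :=
      (List.suffix_append x _).trans (List.suffix_append _ _)
    obtain ⟨q, hq, hxq⟩ := exists_samePrefixes hnil
      (List.replicate n 0 ++ (x ++ 1 :: List.replicate n 0))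
    -- The path spells `0^n x`, not just `x`: only with the zeros in front does it end in the state
    -- of `0^n`.
    refine ⟨⟨hval _ ((List.suffix_cons _ _).trans h1), hval _ h1⟩, q,
      ⟨hq, List.replicate n 0 ++ x, by rwa [List.append_assoc], fun a s h => hval _ ?_⟩, ?_⟩
    · rw [← List.append_assoc]
      obtain ⟨t, ht⟩ := h
      exact ⟨t, by rw [← ht, List.append_assoc]⟩
    · rw [isState_iff hq]
      exact (samePrefixes_append hlen _).trans hxq

end reachable

end ForbiddenDifference

/-! ### The combinatorial criterion for positive capacity. -/

namespace ForbiddenDifference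

section criterion

/-- A word of the form `0 ⋯ 0 + x 0 ⋯ 0`. -/
def paddedWord (n : ℕ) (x : Pattern) : Pattern :=
  List.replicate n 0 ++ 1 :: (x ++ List.replicate n 0)

/-- Neither a pattern of `D` nor the negative of one occurs in `w`. -/
def AvoidsSigned (D : Set Pattern) (w : Pattern) : Prop :=
  ∀ d ∈ D, ¬ d <:+: w ∧ ¬ d.map Neg.neg <:+: w

theorem zeros_eq_replicate (L : List Pattern) : zeros L = List.replicate (zeros L).length 0 := by
  refine List.eq_replicate_iff.2 ⟨rfl, fun a ha => ?_⟩
  simp only [zeros, List.mem_flatMap, List.mem_map] at ha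
  obtain ⟨_, _, _, _, rfl⟩ := ha
  rfl

theorem length_le_length_zeros {L : List Pattern} {d : Pattern} (hd : d ∈ L) :
    d.length ≤ (zeros L).length := by
  simp only [zeros, List.length_flatMap, List.length_map]
  exact List.le_sum_of_mem (List.mem_map.2 ⟨d, hd, rfl⟩)

theorem positiveCapacityTest_iff (L : List Pattern) :
    positiveCapacityTest L = true ↔
      ∃ x, AvoidsSigned {w | w ∈ L} (paddedWord (zeros L).length x) := by
  have hmem : ∀ d, d ∈ reversedPatterns L ↔
      ∃ e ∈ L, d = e.reverse ∨ d = (e.map Neg.neg).reverse := fun d => by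
    simp only [reversedPatterns, List.mem_append, List.mem_map, ← exists_or, ← and_or_left,
      eq_comm]
  have hlen : ∀ d ∈ reversedPatterns L, d.length ≤ (zeros L).length := fun d hd => by
    obtain ⟨e, he, rfl | rfl⟩ := (hmem d).1 hd <;> simpa using length_le_length_zeros he
  rw [positiveCapacityTest, zeros_eq_replicate, hasCycle_iff hlen]
  have hrev : ∀ x, List.replicate (zeros L).length 0 ++
      (x ++ 1 :: List.replicate (zeros L).length 0) =
      (paddedWord (zeros L).length x.reverse).reverse := fun x => by simp [paddedWord]
  simp only [hrev, List.length_replicate]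
  rw [← List.reverse_surjective.exists (p := fun x => ∀ d ∈ reversedPatterns L,
    ¬ d <:+: (paddedWord (zeros L).length x).reverse)]
  refine exists_congr fun x => ⟨fun h d hd => ⟨fun hi => ?_, fun hi => ?_⟩, fun h d hd hi => ?_⟩
  · exact h _ ((hmem _).2 ⟨d, hd, .inl rfl⟩) (List.reverse_infix.2 hi)
  · exact h _ ((hmem _).2 ⟨d, hd, .inr rfl⟩) (List.reverse_infix.2 hi)
  · obtain ⟨e, he, rfl | rfl⟩ := (hmem d).1 hd
    · exact (h e he).1 (List.reverse_infix.1 hi)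
    · exact (h e he).2 (List.reverse_infix.1 hi)

end criterion

section necessary

variable {n N : ℕ} {D : Set Pattern}

/-- Otherwise `logb 2 (delta D N) / N ≤ 2 * n / N` for all large `N`, and the limit would be at most
0. -/
theorem exists_lt_delta (h : 0 < capacity D) (n : ℕ) : ∃ N, 2 * n ≤ N ∧ 2 ^ (2 * n) < delta D N := by
  by_contra! hle
  have h₀ : Filter.Tendsto (fun N : ℕ => ((2 * n : ℕ) : ℝ) / N) Filter.atTop (nhds 0) :=
    tendsto_const_div_atTop_nhds_zero_nat _
  refine h.not_ge (le_of_tendsto_of_tendsto (tendsto_capacity D) h₀ ?_)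
  filter_upwards [Filter.eventually_ge_atTop (2 * n)] with N hN
  gcongr
  rw [Real.logb_le_iff_le_rpow (by norm_num) (by exact_mod_cast one_le_delta D N),
    Real.rpow_natCast]
  exact_mod_cast hle N hN

theorem exists_avoids_of_lt_delta {m : ℕ} (h : m < delta D N) :
    ∃ C : Finset (BinWord N), Avoids C D ∧ m < C.card := by
  by_contra! hle
  exact h.not_ge (delta_le hle)

theorem wordDiff_neg (u v : BinWord N) : (wordDiff u v).map Neg.neg = wordDiff v u := by
  rw [wordDiff, wordDiff, List.map_ofFn]
  congr 1
  funext i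
  simp only [Function.comp_apply]
  cases u i <;> cases v i <;> decide

theorem length_wordDiff (u v : BinWord N) : (wordDiff u v).length = N := by simp [wordDiff]

theorem take_drop_wordDiff {u v : BinWord N} {a b : ℕ} (hab : a + b ≤ N)
    (h : ∀ i : Fin N, a ≤ i → i < a + b → u i = v i) :
    ((wordDiff u v).drop a).take b = List.replicate b 0 := by
  refine List.eq_replicate_iff.2 ⟨by simp [length_wordDiff]; omega, fun x hx => ?_⟩
  obtain ⟨i, hi, rfl⟩ := List.mem_iff_getElem.1 hx
  simp only [List.length_take, List.length_drop, length_wordDiff, lt_inf_iff] at hi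
  simp only [List.getElem_take, List.getElem_drop, wordDiff, List.getElem_ofFn]
  rw [h ⟨a + i, by omega⟩ (by simp) (by simpa using hi.1)]
  cases v ⟨a + i, _⟩ <;> rfl

theorem paddedWord_infix_wordDiff {u v : BinWord N} {k : Fin N} (hn : n ≤ k) (hk : k + n < N)
    (hlt : ∀ i < k, u i = v i) (huv : bitDiff (u k) (v k) = 1)
    (hgt : ∀ i : Fin N, N ≤ i + n → u i = v i) :
    ∃ x, paddedWord n x <:+: wordDiff u v := by
  set e := wordDiff u v with he
  -- `x` is the part strictly between position `k` and the last `n` letters; the padded word is the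
  -- suffix that starts at `k - n`.
  refine ⟨(e.drop (k + 1)).take (N - n - (k + 1)), ?_⟩
  have h₁ : (e.drop (k - n)).take n = List.replicate n 0 :=
    take_drop_wordDiff (by omega) fun i _ hi => hlt i (Fin.lt_def.2 (by omega))
  have h₂ : (e.drop (N - n)).take n = List.replicate n 0 :=
    take_drop_wordDiff (by omega) fun i hi _ => hgt i (by omega)
  have h₃ : (e.drop (N - n)).take n = e.drop (N - n) :=
    List.take_of_length_le (by simp [he, length_wordDiff]; omega)
  have h₄ : e.drop (k + 1) =
      (e.drop (k + 1)).take (N - n - (k + 1)) ++ List.replicate n 0 := by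
    conv_lhs => rw [← List.take_append_drop (N - n - (k + 1)) (e.drop (k + 1))]
    rw [List.drop_drop, ← h₂, h₃]
    congr 2
    omega
  have hkl : (k : ℕ) < e.length := by rw [he, length_wordDiff]; exact k.2
  have h₅ : e.drop k = 1 :: e.drop (k + 1) := by
    rw [List.drop_eq_getElem_cons hkl]
    congr 1
    simpa [he, wordDiff] using huv
  have h₆ : e.drop (k - n) = paddedWord n ((e.drop (k + 1)).take (N - n - (k + 1))) := by
    rw [paddedWord, ← h₄, ← h₅]
    conv_lhs => rw [← List.take_append_drop n (e.drop (k - n)), h₁, List.drop_drop]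
    congr 2
    omega
  rw [← h₆]
  exact (List.drop_suffix _ _).isInfix

theorem exists_avoidsSigned_of_capacity_pos (h : 0 < capacity D) (n : ℕ) :
    ∃ x, AvoidsSigned D (paddedWord n x) := by
  obtain ⟨N, hN, hδ⟩ := exists_lt_delta h n
  obtain ⟨C, hC, hcard⟩ := exists_avoids_of_lt_delta hδ
  let p : BinWord N → (Fin n → Bool) × (Fin n → Bool) := fun u =>
    (fun i => u ⟨i, by omega⟩, fun i => u ⟨N - n + i, by omega⟩)
  -- Pigeonhole: there are only `2 ^ (2 * n)` choices for the first and last `n` letters.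
  obtain ⟨u, hu, v, hv, huv, hp⟩ := Finset.exists_ne_map_eq_of_card_lt_of_maps_to
    (s := C) (t := Finset.univ) (f := p) (by
      simp only [Finset.card_univ, Fintype.card_prod, Fintype.card_fun, Fintype.card_bool,
        Fintype.card_fin]
      rwa [← pow_add, ← two_mul]) (fun _ _ => Finset.mem_coe.2 (Finset.mem_univ _))
  have hsigned : ∀ u ∈ C, ∀ v ∈ C, u ≠ v → AvoidsSigned D (wordDiff u v) :=
    fun u hu v hv huv d hd => ⟨hC u hu v hv huv d hd, fun hi => hC v hv u hu huv.symm d hd (by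
      have := hi.map Neg.neg
      rwa [wordDiff_neg, List.map_map, show (Neg.neg ∘ Neg.neg : SignType → SignType) = id from
        funext neg_neg, List.map_id] at this)⟩
  have hinf : ∀ {w w'}, AvoidsSigned D w → w' <:+: w → AvoidsSigned D w' := fun h hi d hd =>
    ⟨fun h' => (h d hd).1 (h'.trans hi), fun h' => (h d hd).2 (h'.trans hi)⟩
  have hlow : ∀ i : Fin N, (i : ℕ) < n → u i = v i := fun i hi =>
    congrFun (congrArg Prod.fst hp) ⟨i, hi⟩
  have hhigh : ∀ i : Fin N, N ≤ i + n → u i = v i := fun i hi => by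
    have := congrFun (congrArg Prod.snd hp) ⟨i - (N - n), by omega⟩
    simp only [p] at this
    convert this using 2 <;> exact Fin.ext (by simp; omega)
  obtain ⟨k, hk, hmin⟩ : ∃ k : Fin N, u k ≠ v k ∧ ∀ i < k, u i = v i := by
    obtain ⟨k, hk, hmin⟩ := (Finset.univ.filter fun i => u i ≠ v i).exists_minimal
      (by simpa [Finset.filter_nonempty_iff] using Function.ne_iff.1 huv)
    refine ⟨k, by simpa using hk, fun i hi => ?_⟩
    by_contra hne
    exact (hmin (by simpa using hne) hi.le).not_gt hi
  have hnk : n ≤ k := not_lt.1 fun h => hk (hlow k h)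
  have hkN : k + n < N := not_le.1 fun h => hk (hhigh k h)
  -- The order of `u` and `v` is chosen so that the difference at the first disagreement `k` is `+`.
  cases hb : u k with
  | true =>
    have hb' : v k = false := by simpa [hb] using hk.symm
    obtain ⟨x, hx⟩ := paddedWord_infix_wordDiff hnk hkN hmin (by rw [hb, hb']; rfl) hhigh
    exact ⟨x, hinf (hsigned u hu v hv huv) hx⟩
  | false =>
    have hb' : v k = true := by simpa [hb] using hk.symm
    obtain ⟨x, hx⟩ := paddedWord_infix_wordDiff hnk hkN (fun i hi => (hmin i hi).symm)
      (by rw [hb, hb']; rfl) (fun i hi => (hhigh i hi).symm)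
    exact ⟨x, hinf (hsigned v hv u hu huv.symm) hx⟩

end necessary

section sufficient

/-- The word that consists of `k` blocks of length `l`: block `j` is the positive part of `f` if
`j ∈ S`, and the negative part of `f` otherwise. -/
def blockWord (k l : ℕ) (f : ℕ → SignType) (S : Finset ℕ) : BinWord (k * l) := fun i =>
  if (i : ℕ) / l ∈ S then decide (f (i % l) = 1) else decide (f (i % l) = -1)

/-- The positive part of `f` minus its negative part is `f`, so each block of the difference is `f`,
`-f` or zero. -/
theorem bitDiff_blockWord {k l : ℕ} {f : ℕ → SignType} {S T : Finset ℕ} (i : Fin (k * l)) :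
    bitDiff (blockWord k l f S i) (blockWord k l f T i) =
      bitDiff (decide ((i : ℕ) / l ∈ S)) (decide ((i : ℕ) / l ∈ T)) * f (i % l) := by
  unfold blockWord
  by_cases hS : (i : ℕ) / l ∈ S <;> by_cases hT : (i : ℕ) / l ∈ T <;>
    simp only [hS, hT, if_true, if_false, decide_true, decide_false] <;>
    cases f (i % l) <;> decide

theorem avoids_blockWord {D : Set Pattern} {n : ℕ} (hn : ∀ d ∈ D, d.length ≤ n) {x : Pattern}
    (h : AvoidsSigned D (paddedWord n x)) (k : ℕ) (S T : Finset ℕ) {d : Pattern} (hd : d ∈ D) :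
    ¬ d <:+: wordDiff (blockWord k (n + 1 + x.length) (fun i => (paddedWord n x).getD i 0) S)
      (blockWord k (n + 1 + x.length) (fun i => (paddedWord n x).getD i 0) T) := by
  intro hi
  set l := n + 1 + x.length with hl
  set w := paddedWord n x with hw
  have hwl : w.length = l + n := by simp [hw, paddedWord]; omega
  have hlow : ∀ i < n, w.getD i 0 = 0 := fun i hi => by
    rw [hw, paddedWord, List.getD_append _ _ _ _ (by simpa using hi)]
    simp [hi]
  have hhigh : ∀ i, l ≤ i → w.getD i 0 = 0 := fun i hi => by
    have : w = (List.replicate n 0 ++ 1 :: x) ++ List.replicate n 0 := by simp [hw, paddedWord]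
    rw [this, List.getD_append_right _ _ _ _ (by simp; omega)]
    simp
  obtain ⟨s, t, hst⟩ := hi
  -- The occurrence of `d` is a multiple of a window of `w`, where `c` is the sign of the block in
  -- which it starts.
  obtain ⟨c, hc⟩ : ∃ c : SignType, d = ((w.drop (s.length % l)).take d.length).map (c * ·) := by
    refine ⟨bitDiff (decide (s.length / l ∈ S)) (decide (s.length / l ∈ T)), ?_⟩
    have hmod := Nat.mod_lt s.length (show 0 < l by omega)
    have hdn := hn d hd
    refine List.ext_getElem (by simp [hwl]; omega) fun j hj hj' => ?_
    have hdj : d[j] = (s ++ d ++ t)[s.length + j]'(by simp; omega) := by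
      rw [List.getElem_append_left (by simp; omega), List.getElem_append_right (by omega)]
      simp
    have hjl : s.length % l + j < w.length := by omega
    have hlast : (((w.drop (s.length % l)).take d.length).map
        (bitDiff (decide (s.length / l ∈ S)) (decide (s.length / l ∈ T)) * ·))[j] =
        bitDiff (decide (s.length / l ∈ S)) (decide (s.length / l ∈ T)) *
          w.getD (s.length % l + j) 0 := by
      rw [List.getD_eq_getElem _ _ hjl]
      simp
    rw [hlast, hdj]
    simp only [hst, wordDiff, List.getElem_ofFn, bitDiff_blockWord]
    have hdiv := Nat.div_add_mod s.length l
    by_cases hlt : s.length % l + j < l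
    · have h₁ : (s.length + j) / l = s.length / l := by
        rw [← hdiv, add_assoc, Nat.mul_add_div (by omega), Nat.div_eq_of_lt hlt]
        simp [Nat.mul_add_div (show 0 < l by omega), Nat.div_eq_of_lt hmod]
      have h₂ : (s.length + j) % l = s.length % l + j := by
        conv_lhs => rw [← hdiv, add_assoc, Nat.mul_add_mod, Nat.mod_eq_of_lt hlt]
      rw [h₁, h₂]
    -- Past the end of the block, the letter is among the first `n` of the next block and is
    -- compared with one of the last `n` letters of `w`; both are zero, whatever the sign of the
    -- next block.
    · have h₂ : (s.length + j) % l = s.length % l + j - l := by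
        conv_lhs => rw [← hdiv, add_assoc, Nat.mul_add_mod]
        rw [Nat.mod_eq_sub_mod (by omega), Nat.mod_eq_of_lt (by omega)]
      rw [h₂, hlow _ (by omega), hhigh _ (by omega), mul_zero, mul_zero]
  have hinf : (w.drop (s.length % l)).take d.length <:+: w :=
    (List.take_prefix _ _).isInfix.trans (List.drop_suffix _ _).isInfix
  cases c with
  -- Here `d` consists of zeros, and the `n` zeros at the start of `w` already contain it.
  | zero =>
    refine (h d hd).1 ?_
    have : d = List.replicate d.length 0 := List.eq_replicate_iff.2 ⟨rfl, fun a ha => by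
      rw [hc] at ha
      obtain ⟨b, -, rfl⟩ := List.mem_map.1 ha
      cases b <;> rfl⟩
    rw [this, hw]
    refine List.IsInfix.trans (l₂ := List.replicate n 0) ?_ (List.prefix_append _ _).isInfix
    refine List.IsPrefix.isInfix ⟨List.replicate (n - d.length) 0, ?_⟩
    rw [List.replicate_append_replicate, Nat.add_sub_cancel' (hn d hd)]
  | pos =>
    refine (h d hd).1 ?_
    rw [hc]
    convert hinf
    exact (List.map_congr_left fun a _ => by cases a <;> rfl).trans (List.map_id _)
  | neg =>
    refine (h d hd).2 ?_
    rw [hc, List.map_map]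
    convert hinf
    exact (List.map_congr_left fun a _ => by cases a <;> rfl).trans (List.map_id _)

theorem two_pow_le_delta {D : Set Pattern} {n : ℕ} (hn : ∀ d ∈ D, d.length ≤ n) {x : Pattern}
    (h : AvoidsSigned D (paddedWord n x)) (k : ℕ) :
    2 ^ k ≤ delta D (k * (n + 1 + x.length)) := by
  classical
  let f : Finset ℕ → BinWord (k * (n + 1 + x.length)) :=
    blockWord k (n + 1 + x.length) fun i => (paddedWord n x).getD i 0
  have hf : Set.InjOn f (Finset.range k).powerset := by
    intro S hS T hT hST
    simp only [Finset.coe_powerset, Set.mem_preimage, Set.mem_powerset_iff, Finset.coe_subset]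
      at hS hT
    -- Letter `n` of each block comes from the `+` of the padded word, so the bit at `j * l + n`,
    -- with `l = n + 1 + x.length`, records whether `j ∈ S`.
    have key : ∀ j < k, (j ∈ S ↔ j ∈ T) := fun j hj => by
      have hlt : j * (n + 1 + x.length) + n < k * (n + 1 + x.length) :=
        calc j * (n + 1 + x.length) + n < (j + 1) * (n + 1 + x.length) := by
              rw [Nat.add_mul]; omega
          _ ≤ _ := Nat.mul_le_mul_right _ hj
      have hj' := congrFun hST ⟨_, hlt⟩
      have h₁ : (j * (n + 1 + x.length) + n) / (n + 1 + x.length) = j := by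
        rw [mul_comm, Nat.mul_add_div (by omega), Nat.div_eq_of_lt (by omega), add_zero]
      have h₂ : (j * (n + 1 + x.length) + n) % (n + 1 + x.length) = n := by
        rw [mul_comm, Nat.mul_add_mod, Nat.mod_eq_of_lt (by omega)]
      have h₃ : (paddedWord n x).getD n 0 = 1 := by
        rw [paddedWord, List.getD_append_right _ _ _ _ (by simp)]
        simp
      simp only [f, blockWord, h₁, h₂, h₃] at hj'
      by_cases hjS : j ∈ S <;> by_cases hjT : j ∈ T <;> simp_all
    ext j
    exact ⟨fun hj => (key j (Finset.mem_range.1 (hS hj))).1 hj,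
      fun hj => (key j (Finset.mem_range.1 (hT hj))).2 hj⟩
  have hcard : ((Finset.range k).powerset.image f).card = 2 ^ k := by
    rw [Finset.card_image_of_injOn hf, Finset.card_powerset, Finset.card_range]
  rw [← hcard]
  refine card_le_delta fun u hu v hv _ d hd => ?_
  obtain ⟨S, -, rfl⟩ := Finset.mem_image.1 hu
  obtain ⟨T, -, rfl⟩ := Finset.mem_image.1 hv
  exact avoids_blockWord hn h k S T hd

/-- The limit exists, so it can be bounded below along the lengths `k * (n + 1 + x.length)`, where
`two_pow_le_delta` gives rate at least `1 / (n + 1 + x.length)`. -/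
theorem capacity_pos_of_avoidsSigned {D : Set Pattern} {n : ℕ} (hn : ∀ d ∈ D, d.length ≤ n)
    {x : Pattern} (h : AvoidsSigned D (paddedWord n x)) : 0 < capacity D := by
  have hl : 0 < n + 1 + x.length := by omega
  refine lt_of_lt_of_le (show (0 : ℝ) < 1 / (n + 1 + x.length : ℕ) by positivity)
    (ge_of_tendsto ((tendsto_capacity D).comp
      (Filter.tendsto_atTop_mono (fun k => Nat.le_mul_of_pos_right k hl) Filter.tendsto_id)) ?_)
  filter_upwards [Filter.eventually_gt_atTop 0] with k hk
  simp only [Function.comp_apply]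
  have hlog : (k : ℝ) ≤ Real.logb 2 (delta D (k * (n + 1 + x.length))) := by
    rw [Real.le_logb_iff_rpow_le (by norm_num) (by exact_mod_cast one_le_delta D _),
      Real.rpow_natCast]
    exact_mod_cast two_pow_le_delta hn h k
  have hk' : (0 : ℝ) < k := by exact_mod_cast hk
  calc (1 : ℝ) / (n + 1 + x.length : ℕ) = k / (k * (n + 1 + x.length) : ℕ) := by
        push_cast
        field_simp
    _ ≤ _ := by gcongr

end sufficient

theorem positiveCapacityTest_iff_capacity_pos (L : List Pattern) :
    positiveCapacityTest L = true ↔ 0 < capacity {w | w ∈ L} := by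
  rw [positiveCapacityTest_iff]
  exact ⟨fun ⟨_, hx⟩ => capacity_pos_of_avoidsSigned (fun _ hd => length_le_length_zeros hd) hx,
    fun h => exists_avoidsSigned_of_capacity_pos h _⟩

end ForbiddenDifference

theorem mainTheorem4 :
    ForbiddenDifference.DecidableInPolyTime ForbiddenDifference.encodePatterns
      (fun L : List ForbiddenDifference.Pattern =>
        0 < ForbiddenDifference.capacity {w | w ∈ L}) :=
  ⟨ForbiddenDifference.positiveCapacityTest,
    ForbiddenDifference.positiveCapacityTest_iff_capacity_pos,
    (ForbiddenDifference.polyTime_positiveCapacityTest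
      (ForbiddenDifference.polyTime_parse .id)).computableInPolyTime _ _ fun L =>
        congrArg _ (ForbiddenDifference.foldl_parseStep L)⟩
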